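/- Let $\gamma\in\mathbb{R}$ and $\delta>0$, and let $\psi:\mathbb{N}\to\mathbb{R}_{\ge 0}$ (with $\mathbb{N}=\{1,2,\dots\}$) be a function such that $\psi(q)\ge\delta$ for every $q\in\mathbb{N}$ with $\psi(q)\ne 0$. Suppose that $$\sum_{q=1}^{\infty}\frac{\varphi(q)\,\psi(q)}{q}=\infty,$$ where $\varphi$ is Euler's totient function. For $q\in\mathbb{N}$ let $$E'_q=E'_q(\gamma,\psi):=\left\{x\in[0,1]:\ \left|x-\frac{a+\gamma}{q}\right|\le\frac{\psi(q)}{q}\ \text{ for some } a\in\mathbb{Z} \text{ with } \gcd(a,q)=1\right\}.$$ Then $$\mu\Big(\limsup_{q\to\infty}E'_q\Big)=1,$$ where $\mu$ is Lebesgue measure on $\mathbb{R}$ and $\limsup_{q\to\infty}E'_q$ is the set of points that lie in $E'_q$ for infinitely many $q\in\mathbb{N}$. -/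

import Mathlib

open MeasureTheory Filter
open scoped NNReal

/-- The coprime inhomogeneous approximation set `E'_q(γ, ψ)`: those `x ∈ [0,1]` with
`|x - (a + γ) / q| ≤ ψ(q) / q` for some integer `a` coprime to `q`.
It is meant for `q ≥ 1`; the value at `q = 0` does not affect the limsup as `q → ∞`. -/
def coprimeApproxSet (γ : ℝ) (ψ : ℕ → ℝ≥0) (q : ℕ) : Set ℝ :=
  {x | x ∈ Set.Icc (0 : ℝ) 1 ∧
    ∃ a : ℤ, Int.gcd a (q : ℤ) = 1 ∧ |x - ((a : ℝ) + γ) / (q : ℝ)| ≤ (ψ q : ℝ) / (q : ℝ)}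

/-! Let `f_q(x)` count the coprime numerators `a` with `|x - (a + γ) / q| ≤ ψ(q) / q`, and let
`w_q = φ(q) ψ(q) / q`. If `ψ(q) ≥ q` infinitely often, those `E'_q` are all of `[0, 1]`. Otherwise,
the Legendre sieve gives `∫_I f_q ≫ |I| w_q` for every interval `I` and all large `q`. The heart of
the matter is the pair correlation `∫ f_q f_r ≪ w_q w_r + [q = r] w_q`: with `q = d m`, `r = d n`
and `m`, `n` coprime, two approximation intervals meet only if the determinant `k = a n - b m` is
small. A nonzero `k` occurs for as many pairs `(a, b)` as a product of two linear forms takes unit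
values modulo `d`, which is the expected number up to the factor `k / φ(k)`; averaged over `k`
coprime to `m n`, that factor is harmless, because `ψ ≥ δ` makes the range of `k` as long as
`m + n`. Finally, if a set `B` of positive measure escaped the limsup, the Cauchy–Schwarz
inequality on a union of intervals that exceeds `B` by very little would contradict the local lower
bound.
-/

section Totient

open Finset

theorem totient_div_self_eq_prod {n : ℕ} (hn : n ≠ 0) :
    (n.totient : ℝ) / n = ∏ p ∈ n.primeFactors, (1 - (p : ℝ)⁻¹) := by
  have h : (n.totient : ℝ) = n * ∏ p ∈ n.primeFactors, (1 - (p : ℝ)⁻¹) := by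
    simpa using congrArg (Rat.cast : ℚ → ℝ) (Nat.totient_eq_mul_prod_factors n)
  rw [h, mul_div_cancel_left₀ _ (Nat.cast_ne_zero.2 hn)]

theorem one_sub_inv_prime_pos {p : ℕ} (hp : p.Prime) : 0 < 1 - (p : ℝ)⁻¹ :=
  sub_pos.2 (inv_lt_one_of_one_lt₀ (by exact_mod_cast hp.one_lt))

theorem totient_div_self_pos {n : ℕ} (hn : n ≠ 0) : 0 < (n.totient : ℝ) / n := by
  have := Nat.totient_pos.2 (Nat.pos_of_ne_zero hn)
  positivity

theorem prod_primeFactors_pred_le_totient {n : ℕ} (hn : n ≠ 0) :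
    ∏ p ∈ n.primeFactors, (p - 1) ≤ n.totient := by
  rw [Nat.totient_eq_div_primeFactors_mul]
  exact Nat.le_mul_of_pos_left _ <|
    Nat.div_pos (Nat.le_of_dvd (Nat.pos_of_ne_zero hn) (Nat.prod_primeFactors_dvd n))
      (prod_pos fun p hp => (Nat.prime_of_mem_primeFactors hp).pos)

theorem four_pow_card_primeFactors_le {n : ℕ} (hn : n ≠ 0) :
    4 ^ #n.primeFactors ≤ 16 * n.totient := by
  have small : ∏ p ∈ n.primeFactors, (if p = 2 ∨ p = 3 then 4 else 1) ≤ 16 := by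
    rw [← prod_filter, prod_const]
    have hcard : #{p ∈ n.primeFactors | p = 2 ∨ p = 3} ≤ #{2, 3} :=
      card_le_card fun p hp => by simpa using (mem_filter.1 hp).2
    exact Nat.pow_le_pow_right (by norm_num) hcard
  calc 4 ^ #n.primeFactors = ∏ p ∈ n.primeFactors, 4 := by rw [prod_const]
    _ ≤ ∏ p ∈ n.primeFactors, ((if p = 2 ∨ p = 3 then 4 else 1) * (p - 1)) := by
        refine prod_le_prod' fun p hp => ?_
        have hp := Nat.prime_of_mem_primeFactors hp
        split_ifs with h
        · rcases h with rfl | rfl <;> norm_num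
        · have := hp.two_le
          have : p ≠ 4 := by rintro rfl; norm_num at hp
          lia
    _ ≤ 16 * n.totient := by
        rw [prod_mul_distrib]
        exact Nat.mul_le_mul small (prod_primeFactors_pred_le_totient hn)

theorem self_le_totient_mul_two_pow {n : ℕ} (hn : n ≠ 0) :
    n ≤ n.totient * 2 ^ #n.primeFactors := by
  have hn' : (0 : ℝ) < n := by positivity
  have h : (2⁻¹ : ℝ) ^ #n.primeFactors ≤ n.totient / n := by
    rw [totient_div_self_eq_prod hn, ← prod_const]
    refine prod_le_prod (fun _ _ => by norm_num) fun p hp => ?_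
    have : (p : ℝ)⁻¹ ≤ 2⁻¹ := by
      gcongr
      exact_mod_cast (Nat.prime_of_mem_primeFactors hp).two_le
    linarith
  rw [inv_pow, le_div_iff₀ hn', inv_mul_le_iff₀ (by positivity), mul_comm] at h
  exact_mod_cast h

theorem sq_le_sixteen_mul_totient_cube (n : ℕ) : n ^ 2 ≤ 16 * n.totient ^ 3 := by
  rcases eq_or_ne n 0 with rfl | hn
  · simp
  calc n ^ 2 ≤ (n.totient * 2 ^ #n.primeFactors) ^ 2 :=
        Nat.pow_le_pow_left (self_le_totient_mul_two_pow hn) 2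
    _ = n.totient ^ 2 * 4 ^ #n.primeFactors := by
        rw [mul_pow, ← pow_mul, mul_comm #n.primeFactors, pow_mul]; norm_num
    _ ≤ n.totient ^ 2 * (16 * n.totient) :=
        Nat.mul_le_mul_left _ (four_pow_card_primeFactors_le hn)
    _ = 16 * n.totient ^ 3 := by ring

theorem tendsto_totient_atTop : Tendsto Nat.totient atTop atTop := by
  refine tendsto_atTop.2 fun b => ?_
  filter_upwards [eventually_gt_atTop (16 * b ^ 3)] with n hn
  by_contra! h
  have h1 := sq_le_sixteen_mul_totient_cube n
  have h2 : n.totient ^ 3 ≤ b ^ 3 := Nat.pow_le_pow_left h.le 3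
  nlinarith

theorem two_inv_le_prod_primeFactors_one_sub_inv_sq (n : ℕ) :
    (2 : ℝ)⁻¹ ≤ ∏ p ∈ n.primeFactors, (1 - ((p : ℝ) ^ 2)⁻¹) := by
  have telescope (N : ℕ) :
      ∏ k ∈ range N, (1 - (((k + 2 : ℕ) : ℝ) ^ 2)⁻¹) = (N + 2) / (2 * (N + 1)) := by
    induction N with
    | zero => simp
    | succ N ih =>
      rw [prod_range_succ, ih]
      push_cast
      field_simp
      ring
  have factor_nonneg {k : ℕ} (hk : 2 ≤ k) : 0 ≤ 1 - ((k : ℝ) ^ 2)⁻¹ :=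
    sub_nonneg.2 (inv_le_one_of_one_le₀ (one_le_pow₀ (by exact_mod_cast one_le_two.trans hk)))
  calc (2 : ℝ)⁻¹ ≤ (n + 2) / (2 * (n + 1)) := by
        rw [le_div_iff₀ (by positivity)]; linarith
    _ = ∏ k ∈ (range n).map (addRightEmbedding 2), (1 - ((k : ℝ) ^ 2)⁻¹) := by
        rw [prod_map, ← telescope]; rfl
    _ ≤ ∏ p ∈ n.primeFactors, (1 - ((p : ℝ) ^ 2)⁻¹) := by
        refine prod_le_prod_of_subset_of_le_one (fun p hp => ?_) (fun k hk => ?_)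
          fun k _ _ => by linarith [show 0 ≤ ((k : ℝ) ^ 2)⁻¹ by positivity]
        · have h2 := (Nat.prime_of_mem_primeFactors hp).two_le
          have := Nat.le_of_mem_primeFactors hp
          exact Finset.mem_map.2 ⟨p - 2, mem_range.2 (by lia), by simp; lia⟩
        · obtain ⟨j, -, rfl⟩ := Finset.mem_map.1 hk
          exact factor_nonneg (by simp)

theorem prod_primeFactors_one_add_inv_le {n : ℕ} (hn : n ≠ 0) :
    ∏ p ∈ n.primeFactors, (1 + (p : ℝ)⁻¹) ≤ ∑ e ∈ n.divisors, (e : ℝ)⁻¹ := by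
  have prime_of_mem {t : Finset ℕ} (ht : t ∈ n.primeFactors.powerset) {p : ℕ} (hp : p ∈ t) :
      p.Prime := Nat.prime_of_mem_primeFactors (mem_powerset.1 ht hp)
  have prod_injOn : Set.InjOn (fun t : Finset ℕ => ∏ p ∈ t, p) n.primeFactors.powerset :=
    fun s hs t ht hst => by
      rw [← Nat.primeFactors_prod fun p => prime_of_mem hs,
        ← Nat.primeFactors_prod fun p => prime_of_mem ht]
      exact congrArg Nat.primeFactors hst
  calc ∏ p ∈ n.primeFactors, (1 + (p : ℝ)⁻¹)
      = ∑ e ∈ n.primeFactors.powerset.image fun t => ∏ p ∈ t, p, (e : ℝ)⁻¹ := by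
        rw [sum_image prod_injOn, prod_one_add]
        simp only [prod_inv_distrib, Nat.cast_prod]
    _ ≤ ∑ e ∈ n.divisors, (e : ℝ)⁻¹ := by
        refine sum_le_sum_of_subset_of_nonneg (image_subset_iff.2 fun t ht => ?_)
          fun _ _ _ => by positivity
        exact Nat.mem_divisors.2 ⟨(prod_dvd_prod_of_subset _ _ _ (mem_powerset.1 ht)).trans
          (Nat.prod_primeFactors_dvd n), hn⟩

theorem self_div_totient_le_two_mul_sum_inv_divisors {n : ℕ} (hn : n ≠ 0) :
    (n : ℝ) / n.totient ≤ 2 * ∑ e ∈ n.divisors, (e : ℝ)⁻¹ := by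
  have key : 2⁻¹ ≤ (n.totient : ℝ) / n * ∑ e ∈ n.divisors, (e : ℝ)⁻¹ :=
    calc (2 : ℝ)⁻¹ ≤ ∏ p ∈ n.primeFactors, (1 - ((p : ℝ) ^ 2)⁻¹) :=
          two_inv_le_prod_primeFactors_one_sub_inv_sq n
      _ = (n.totient : ℝ) / n * ∏ p ∈ n.primeFactors, (1 + (p : ℝ)⁻¹) := by
          rw [totient_div_self_eq_prod hn, ← prod_mul_distrib]
          exact prod_congr rfl fun p _ => by ring
      _ ≤ _ := mul_le_mul_of_nonneg_left (prod_primeFactors_one_add_inv_le hn) (by positivity)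
  rw [← inv_div, inv_le_iff_one_le_mul₀ (totient_div_self_pos hn)]
  linarith

theorem sum_coprime_inv_mul_sum_divisors_inv_le (N : ℕ) {P : ℕ} (hP : P ≠ 0) :
    (∑ l ∈ Ioc 0 N with l.Coprime P, (l : ℝ)⁻¹) * ∑ e ∈ P.divisors, (e : ℝ)⁻¹ ≤
      1 + Real.log (N * P) := by
  have mul_injOn : Set.InjOn (fun x : ℕ × ℕ => x.1 * x.2)
      ({l ∈ Ioc 0 N | l.Coprime P} ×ˢ P.divisors : Finset (ℕ × ℕ)) := by
    rintro ⟨l, e⟩ hx ⟨l', e'⟩ hx' h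
    simp only [coe_product, Set.mem_prod, mem_coe, mem_filter, Nat.mem_divisors] at hx hx' h
    have he : e = e' :=
      calc e = (l * e).gcd P := by
            rw [hx.1.2.gcd_mul_left_cancel e, Nat.gcd_eq_left hx.2.1]
        _ = (l' * e').gcd P := by rw [h]
        _ = e' := by rw [hx'.1.2.gcd_mul_left_cancel e', Nat.gcd_eq_left hx'.2.1]
    subst he
    exact Prod.ext (Nat.eq_of_mul_eq_mul_right (Nat.pos_of_dvd_of_pos hx.2.1 (by lia)) h) rfl
  calc _ = ∑ k ∈ ({l ∈ Ioc 0 N | l.Coprime P} ×ˢ P.divisors).image (fun x : ℕ × ℕ => x.1 * x.2),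
        (k : ℝ)⁻¹ := by
        rw [sum_image mul_injOn, sum_mul_sum, sum_product]
        simp only [Nat.cast_mul, mul_inv]
    _ ≤ ∑ k ∈ Icc 1 (N * P), (k : ℝ)⁻¹ := by
        refine sum_le_sum_of_subset_of_nonneg (image_subset_iff.2 fun x hx => ?_)
          fun _ _ _ => by positivity
        simp only [mem_product, mem_filter, mem_Ioc] at hx
        exact mem_Icc.2 ⟨Nat.mul_pos hx.1.1.1 (Nat.pos_of_mem_divisors hx.2),
          Nat.mul_le_mul hx.1.1.2 (Nat.divisor_le hx.2)⟩
    _ ≤ 1 + Real.log (N * P) := by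
        simpa [harmonic_eq_sum_Icc] using harmonic_le_one_add_log (N * P)

theorem sum_coprime_inv_le (N : ℕ) {P : ℕ} (hP : P ≠ 0) :
    ∑ l ∈ Ioc 0 N with l.Coprime P, (l : ℝ)⁻¹ ≤
      2 * (1 + Real.log (N * P)) * (P.totient / P) := by
  rw [← div_le_iff₀ (totient_div_self_pos hP), div_div_eq_mul_div, mul_div_assoc]
  calc _ ≤ (∑ l ∈ Ioc 0 N with l.Coprime P, (l : ℝ)⁻¹) * (2 * ∑ e ∈ P.divisors, (e : ℝ)⁻¹) := by
        gcongr
        exact self_div_totient_le_two_mul_sum_inv_divisors hP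
    _ = 2 * ((∑ l ∈ Ioc 0 N with l.Coprime P, (l : ℝ)⁻¹) * ∑ e ∈ P.divisors, (e : ℝ)⁻¹) := by ring
    _ ≤ _ := by gcongr; exact sum_coprime_inv_mul_sum_divisors_inv_le N hP

theorem sum_Ioc_sum_divisors {R : Type*} [AddCommMonoid R] (N : ℕ) (G : ℕ → ℕ → R) :
    ∑ n ∈ Ioc 0 N, ∑ e ∈ n.divisors, G e (n / e) =
      ∑ e ∈ Ioc 0 N, ∑ l ∈ Ioc 0 (N / e), G e l := by
  rw [sum_sigma', sum_sigma']
  refine sum_bij' (fun x _ => ⟨x.2, x.1 / x.2⟩) (fun y _ => ⟨y.1 * y.2, y.1⟩) ?_ ?_ ?_ ?_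
    fun _ _ => rfl
  · rintro ⟨n, e⟩ h
    simp only [mem_sigma, mem_Ioc, Nat.mem_divisors] at h ⊢
    obtain ⟨⟨hn, hnN⟩, hen, -⟩ := h
    have he := Nat.pos_of_dvd_of_pos hen hn
    have hle := Nat.le_of_dvd hn hen
    exact ⟨⟨he, hle.trans hnN⟩, Nat.div_pos hle he, Nat.div_le_div_right hnN⟩
  · rintro ⟨e, l⟩ h
    simp only [mem_sigma, mem_Ioc, Nat.mem_divisors] at h ⊢
    obtain ⟨⟨he, -⟩, hl, hlN⟩ := h
    exact ⟨⟨Nat.mul_pos he hl, Nat.mul_le_of_le_div _ _ _ hlN |> (mul_comm e l ▸ ·)⟩,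
      dvd_mul_right e l, (Nat.mul_pos he hl).ne'⟩
  · rintro ⟨n, e⟩ h
    simp only [mem_sigma, mem_Ioc, Nat.mem_divisors] at h
    simp only [Nat.mul_div_cancel' h.2.1]
  · rintro ⟨e, l⟩ h
    simp only [mem_sigma, mem_Ioc] at h
    simp only [Nat.mul_div_cancel_left l h.1.1]

theorem sum_Ioc_inv_sq_le_two (N : ℕ) : ∑ e ∈ Ioc 0 N, ((e : ℝ) ^ 2)⁻¹ ≤ 2 := by
  have h := sum_Ioo_inv_sq_le (α := ℝ) 0 (N + 1)
  rwa [Ioo_add_one_right_eq_Ioc, Nat.cast_zero, zero_add, div_one] at h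

theorem sum_coprime_inv_totient_le_four_mul (N P : ℕ) :
    ∑ l ∈ Ioc 0 N with l.Coprime P, (l.totient : ℝ)⁻¹ ≤
      4 * ∑ l ∈ Ioc 0 N with l.Coprime P, (l : ℝ)⁻¹ := by
  let g (l : ℕ) : ℝ := if l.Coprime P then (l : ℝ)⁻¹ else 0
  have g_nonneg (l : ℕ) : 0 ≤ g l := by
    simp only [g]; split_ifs <;> positivity
  have pointwise {l : ℕ} (hl : l ≠ 0) (hlP : l.Coprime P) :
      (l.totient : ℝ)⁻¹ ≤ 2 * ∑ e ∈ l.divisors, ((e : ℝ) ^ 2)⁻¹ * g (l / e) :=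
    calc (l.totient : ℝ)⁻¹ = (l : ℝ)⁻¹ * (l / l.totient) := by field_simp
      _ ≤ (l : ℝ)⁻¹ * (2 * ∑ e ∈ l.divisors, (e : ℝ)⁻¹) := by
          gcongr
          exact self_div_totient_le_two_mul_sum_inv_divisors hl
      _ = 2 * ∑ e ∈ l.divisors, ((e : ℝ) ^ 2)⁻¹ * g (l / e) := by
          rw [mul_left_comm, mul_sum]
          congr 1
          refine sum_congr rfl fun e he => ?_
          have hel := Nat.dvd_of_mem_divisors he
          have he0 : (e : ℝ) ≠ 0 := by exact_mod_cast (Nat.pos_of_mem_divisors he).ne'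
          simp only [g, if_pos (hlP.coprime_dvd_left (Nat.div_dvd_of_dvd hel))]
          rw [Nat.cast_div hel he0]
          field_simp
  calc ∑ l ∈ Ioc 0 N with l.Coprime P, (l.totient : ℝ)⁻¹
      ≤ ∑ l ∈ Ioc 0 N, 2 * ∑ e ∈ l.divisors, ((e : ℝ) ^ 2)⁻¹ * g (l / e) := by
        rw [sum_filter]
        refine sum_le_sum fun l hl => ?_
        split_ifs with hlP
        · exact pointwise (mem_Ioc.1 hl).1.ne' hlP
        · exact mul_nonneg two_pos.le <| sum_nonneg fun e _ =>
            mul_nonneg (by positivity) (g_nonneg _)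
    _ = 2 * ∑ e ∈ Ioc 0 N, ((e : ℝ) ^ 2)⁻¹ * ∑ l ∈ Ioc 0 (N / e), g l := by
        rw [← mul_sum, sum_Ioc_sum_divisors N fun e l => ((e : ℝ) ^ 2)⁻¹ * g l]
        simp only [mul_sum]
    _ ≤ 2 * ∑ e ∈ Ioc 0 N, ((e : ℝ) ^ 2)⁻¹ * ∑ l ∈ Ioc 0 N, g l := by
        gcongr with e
        exact Nat.div_le_self N e
    _ ≤ 2 * (2 * ∑ l ∈ Ioc 0 N, g l) := by
        rw [← sum_mul]
        gcongr
        exact sum_Ioc_inv_sq_le_two N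
    _ = 4 * ∑ l ∈ Ioc 0 N with l.Coprime P, (l : ℝ)⁻¹ := by
        rw [sum_filter]; ring

theorem sum_coprime_inv_totient_le (N : ℕ) {P : ℕ} (hP : P ≠ 0) :
    ∑ l ∈ Ioc 0 N with l.Coprime P, (l.totient : ℝ)⁻¹ ≤
      8 * (1 + Real.log (N * P)) * (P.totient / P) :=
  calc _ ≤ 4 * ∑ l ∈ Ioc 0 N with l.Coprime P, (l : ℝ)⁻¹ :=
        sum_coprime_inv_totient_le_four_mul N P
    _ ≤ 4 * (2 * (1 + Real.log (N * P)) * (P.totient / P)) := by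
        gcongr
        exact sum_coprime_inv_le N hP
    _ = _ := by ring

theorem self_div_totient_mul_le (a b : ℕ) :
    ((a * b : ℕ) : ℝ) / (a * b).totient ≤ a / a.totient * (b / b.totient) := by
  rcases eq_or_ne a 0 with rfl | ha
  · simp
  rcases eq_or_ne b 0 with rfl | hb
  · simp
  have : (0 : ℝ) < a.totient := by exact_mod_cast Nat.totient_pos.2 (Nat.pos_of_ne_zero ha)
  have : (0 : ℝ) < b.totient := by exact_mod_cast Nat.totient_pos.2 (Nat.pos_of_ne_zero hb)
  rw [div_mul_div_comm, Nat.cast_mul]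
  gcongr
  exact_mod_cast Nat.totient_super_multiplicative a b

theorem self_div_totient_le_two_of_isPrimePow {e : ℕ} (he : IsPrimePow e) :
    (e : ℝ) / e.totient ≤ 2 := by
  obtain ⟨p, k, hp, hk, rfl⟩ := (isPrimePow_nat_iff e).1 he
  have h2 : (p : ℝ)⁻¹ ≤ 2⁻¹ := by
    gcongr
    exact_mod_cast hp.two_le
  rw [← inv_div, totient_div_self_eq_prod (pow_pos hp.pos k).ne',
    Nat.primeFactors_prime_pow hk.ne' hp, prod_singleton]
  exact inv_le_of_inv_le₀ two_pos (by linarith)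

section Sieve

variable {f : ℕ → ℝ} {K : ℝ}

open ArithmeticFunction (vonMangoldt) in
theorem sum_mul_log_le (hf : ∀ n, 0 ≤ f n) (hK : 0 ≤ K)
    (hfK : ∀ l e, IsPrimePow e → f (l * e) ≤ K * f l) (N : ℕ) :
    ∑ k ∈ Ioc 0 N, f k * Real.log k ≤ K * (Real.log 4 + 4) * N * ∑ l ∈ Ioc 0 N, f l / l := by
  have pointwise (k l : ℕ) (hlk : l ∣ k) :
      f k * vonMangoldt (k / l) ≤ K * f l * vonMangoldt (k / l) := by
    by_cases hkl : IsPrimePow (k / l)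
    · gcongr
      simpa [Nat.mul_div_cancel' hlk] using hfK l (k / l) hkl
    · simp [ArithmeticFunction.vonMangoldt_eq_zero_iff.2 hkl]
  have chebyshev (l : ℕ) :
      ∑ e ∈ Ioc 0 (N / l), vonMangoldt e ≤ (Real.log 4 + 4) * (N / l) := by
    have := Chebyshev.psi_le_const_mul_self (x := (N : ℝ) / l) (by positivity)
    rwa [Chebyshev.psi, Nat.floor_div_natCast, Nat.floor_natCast] at this
  calc ∑ k ∈ Ioc 0 N, f k * Real.log k
      = ∑ k ∈ Ioc 0 N, ∑ l ∈ k.divisors, f k * vonMangoldt (k / l) := by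
        simp only [← ArithmeticFunction.vonMangoldt_sum, mul_sum]
        exact sum_congr rfl fun k _ => (Nat.sum_div_divisors k fun e => f k * vonMangoldt e).symm
    _ ≤ ∑ k ∈ Ioc 0 N, ∑ l ∈ k.divisors, K * f l * vonMangoldt (k / l) :=
        sum_le_sum fun k _ => sum_le_sum fun l hl => pointwise k l (Nat.dvd_of_mem_divisors hl)
    _ = ∑ l ∈ Ioc 0 N, K * f l * ∑ e ∈ Ioc 0 (N / l), vonMangoldt e := by
        rw [sum_Ioc_sum_divisors N fun l e => K * f l * vonMangoldt e]
        simp only [mul_sum]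
    _ ≤ ∑ l ∈ Ioc 0 N, K * f l * ((Real.log 4 + 4) * (N / l)) := by
        gcongr with l
        · exact mul_nonneg hK (hf l)
        · exact chebyshev l
    _ = _ := by
        rw [mul_sum]
        exact sum_congr rfl fun l _ => by ring

theorem sum_mul_log_div_le (hf : ∀ n, 0 ≤ f n) (N : ℕ) :
    ∑ k ∈ Ioc 0 N, f k * (Real.log N - Real.log k) ≤ N * ∑ k ∈ Ioc 0 N, f k / k := by
  rw [mul_sum]
  refine sum_le_sum fun k hk => ?_
  obtain ⟨hk0, hkN⟩ := mem_Ioc.1 hk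
  have hk' : (0 : ℝ) < k := by exact_mod_cast hk0
  have hN' : (0 : ℝ) < N := hk'.trans_le (by exact_mod_cast hkN)
  calc f k * (Real.log N - Real.log k) ≤ f k * (N / k) := by
        rw [← Real.log_div hN'.ne' hk'.ne']
        exact mul_le_mul_of_nonneg_left (Real.log_le_self (by positivity)) (hf k)
    _ = N * (f k / k) := by ring

theorem log_mul_sum_le (hf : ∀ n, 0 ≤ f n) (hK : 0 ≤ K)
    (hfK : ∀ l e, IsPrimePow e → f (l * e) ≤ K * f l) (N : ℕ) :
    Real.log N * ∑ k ∈ Ioc 0 N, f k ≤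
      (K * (Real.log 4 + 4) + 1) * N * ∑ k ∈ Ioc 0 N, f k / k :=
  calc Real.log N * ∑ k ∈ Ioc 0 N, f k
      = ∑ k ∈ Ioc 0 N, f k * Real.log k + ∑ k ∈ Ioc 0 N, f k * (Real.log N - Real.log k) := by
        rw [← sum_add_distrib, mul_sum]
        exact sum_congr rfl fun k _ => by ring
    _ ≤ _ := add_le_add (sum_mul_log_le hf hK hfK N) (sum_mul_log_div_le hf N)
    _ = _ := by ring

end Sieve

theorem log_mul_sum_coprime_self_div_totient_le (N P : ℕ) :
    Real.log N * ∑ k ∈ Ioc 0 N with k.Coprime P, (k : ℝ) / k.totient ≤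
      12 * N * ∑ k ∈ Ioc 0 N with k.Coprime P, (k.totient : ℝ)⁻¹ := by
  let f (k : ℕ) : ℝ := if k.Coprime P then (k : ℝ) / k.totient else 0
  have f_nonneg (k : ℕ) : 0 ≤ f k := by
    simp only [f]; split_ifs <;> positivity
  have f_mul_le (l e : ℕ) (he : IsPrimePow e) : f (l * e) ≤ 2 * f l := by
    by_cases hle : (l * e).Coprime P
    · simp only [f, if_pos hle, if_pos (hle.coprime_dvd_left (Dvd.intro e rfl))]
      calc _ ≤ (l : ℝ) / l.totient * (e / e.totient) := self_div_totient_mul_le l e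
        _ ≤ l / l.totient * 2 := by
            gcongr
            exact self_div_totient_le_two_of_isPrimePow he
        _ = _ := mul_comm _ _
    · simpa only [f, if_neg hle] using mul_nonneg two_pos.le (f_nonneg l)
  have f_div_self {k : ℕ} (hk : k ∈ Ioc 0 N) :
      f k / k = if k.Coprime P then (k.totient : ℝ)⁻¹ else 0 := by
    have : (k : ℝ) ≠ 0 := by exact_mod_cast (mem_Ioc.1 hk).1.ne'
    simp only [f, ite_div, zero_div]
    congr 1
    field_simp
  have log_four : Real.log 4 ≤ 3 / 2 := by
    rw [show (4 : ℝ) = 2 ^ 2 by norm_num, Real.log_pow]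
    linarith [Real.log_two_lt_d9]
  calc _ = Real.log N * ∑ k ∈ Ioc 0 N, f k := by rw [sum_filter]
    _ ≤ (2 * (Real.log 4 + 4) + 1) * N * ∑ k ∈ Ioc 0 N, f k / k :=
        log_mul_sum_le f_nonneg two_pos.le f_mul_le N
    _ ≤ 12 * N * ∑ k ∈ Ioc 0 N, f k / k := by
        gcongr
        linarith
    _ = _ := by rw [sum_congr rfl fun k => f_div_self, sum_filter]

theorem sum_coprime_self_div_totient_le {N P : ℕ} (hN : 2 ≤ N) (hP : P ≠ 0) (hPN : P ≤ N ^ 2) :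
    ∑ k ∈ Ioc 0 N with k.Coprime P, (k : ℝ) / k.totient ≤ 480 * N * (P.totient / P) := by
  have log_two_le : Real.log 2 ≤ Real.log N := Real.log_le_log two_pos (by exact_mod_cast hN)
  have one_add_log_le : 1 + Real.log (N * P) ≤ 5 * Real.log N :=
    calc 1 + Real.log (N * P) ≤ 1 + Real.log (N ^ 3) := by
          gcongr
          rw [pow_succ' (N : ℝ) 2]
          gcongr
          exact_mod_cast hPN
      _ = 1 + 3 * Real.log N := by rw [Real.log_pow]; norm_num
      _ ≤ 5 * Real.log N := by linarith [Real.log_two_gt_d9]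
  refine le_of_mul_le_mul_left ?_ (show 0 < Real.log N by linarith [Real.log_two_gt_d9])
  calc _ ≤ 12 * N * ∑ k ∈ Ioc 0 N with k.Coprime P, (k.totient : ℝ)⁻¹ :=
        log_mul_sum_coprime_self_div_totient_le N P
    _ ≤ 12 * N * (8 * (5 * Real.log N) * (P.totient / P)) := by
        gcongr
        refine (sum_coprime_inv_totient_le N hP).trans ?_
        gcongr
    _ = Real.log N * (480 * N * (P.totient / P)) := by ring
end Totient

section UnitValues

open Finset Polynomial

/-- The number of residues modulo `d` at which the polynomial `f` takes a unit value. -/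
noncomputable def unitValueCount (f : ℤ[X]) (d : ℕ) : ℕ :=
  Nat.card {t : ZMod d // IsUnit (aeval t f)}

theorem isUnit_aeval_intCast_iff (f : ℤ[X]) (d : ℕ) (t : ℤ) :
    IsUnit (aeval (t : ZMod d) f) ↔ Int.gcd (f.eval t) d = 1 := by
  rw [← Int.isCoprime_iff_gcd_eq_one, isCoprime_comm, ← ZMod.coe_int_isUnit_iff_isCoprime,
    ← eq_intCast (algebraMap ℤ (ZMod d)), aeval_algebraMap_apply_eq_algebraMap_eval, eq_intCast]

theorem card_Ico_gcd_eval_eq_one (f : ℤ[X]) {d : ℕ} (hd : d ≠ 0) (c : ℕ) (u : ℤ) :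
    #{t ∈ Ico u (u + c * d) | Int.gcd (f.eval t) d = 1} = c * unitValueCount f d := by
  classical
  have : NeZero d := ⟨hd⟩
  set T := {t ∈ Ico u (u + c * d) | Int.gcd (f.eval t) d = 1} with hT
  have maps : ∀ t ∈ T, (t : ZMod d) ∈ ({t | IsUnit (aeval t f)} : Finset (ZMod d)) :=
    fun t ht => mem_filter.2 ⟨mem_univ _, (isUnit_aeval_intCast_iff f d t).2 (mem_filter.1 ht).2⟩
  have fiber : ∀ v ∈ ({t | IsUnit (aeval t f)} : Finset (ZMod d)),
      #{t ∈ T | ((t : ℤ) : ZMod d) = v} = c := by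
    intro v hv
    obtain ⟨v, rfl⟩ := ZMod.intCast_surjective v
    have residues : {t ∈ T | ((t : ℤ) : ZMod d) = v} =
        {t ∈ Ico u (u + c * d) | t ≡ v [ZMOD d]} := by
      ext t
      simp only [hT, mem_filter, mem_univ, true_and, ← isUnit_aeval_intCast_iff,
        ← ZMod.intCast_eq_intCast_iff] at hv ⊢
      exact ⟨fun h => ⟨h.1.1, h.2⟩, fun h => ⟨⟨h.1, h.2 ▸ hv⟩, h.2⟩⟩
    have shift : ((u + c * d : ℤ) - v : ℚ) / (d : ℤ) = (u - v) / (d : ℤ) + (c : ℤ) := by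
      push_cast
      field_simp
      ring
    zify
    rw [residues, Int.Ico_filter_modEq_card _ _ (by exact_mod_cast Nat.pos_of_ne_zero hd), shift,
      Int.ceil_add_intCast, add_sub_cancel_left, max_eq_left (Int.natCast_nonneg c)]
  rw [card_eq_sum_card_fiberwise maps, sum_congr rfl fiber, sum_const, smul_eq_mul, mul_comm,
    unitValueCount, Nat.card_eq_fintype_card, Fintype.card_subtype]

theorem unitValueCount_mul (f : ℤ[X]) {d e : ℕ} (h : d.Coprime e) :
    unitValueCount f (d * e) = unitValueCount f d * unitValueCount f e := by
  rw [unitValueCount, unitValueCount, unitValueCount, ← Nat.card_prod]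
  refine Nat.card_congr (((ZMod.chineseRemainder h).toEquiv.subtypeEquiv fun t => ?_).trans
    (Equiv.subtypeProdEquivProd (p := fun t : ZMod d => IsUnit (aeval t f))
      (q := fun t : ZMod e => IsUnit (aeval t f))))
  rw [← isUnit_map_iff (ZMod.chineseRemainder h), Prod.isUnit_iff]
  have components (R : Type) [CommRing R] (φ : ZMod (d * e) →+* R) :
      φ (aeval t f) = aeval (φ t) f := (aeval_algHom_apply φ.toIntAlgHom t f).symm
  exact and_congr
    (iff_of_eq (congrArg IsUnit (components _ ((RingHom.fst _ _).comp
      (ZMod.chineseRemainder h).toRingHom))))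
    (iff_of_eq (congrArg IsUnit (components _ ((RingHom.snd _ _).comp
      (ZMod.chineseRemainder h).toRingHom))))

theorem unitValueCount_prime_pow (f : ℤ[X]) {p k : ℕ} (hp : p.Prime) (hk : k ≠ 0) :
    unitValueCount f (p ^ k) = p ^ (k - 1) * unitValueCount f p := by
  have split : (p ^ k : ℤ) = (p ^ (k - 1) : ℕ) * p := by
    exact_mod_cast (pow_sub_one_mul hk p).symm
  have coprime_iff (t : ℤ) : Int.gcd (f.eval t) (p ^ k : ℕ) = 1 ↔ Int.gcd (f.eval t) p = 1 := by
    rw [← Int.isCoprime_iff_gcd_eq_one, ← Int.isCoprime_iff_gcd_eq_one, Nat.cast_pow,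
      IsCoprime.pow_right_iff (Nat.pos_of_ne_zero hk)]
  have h := card_Ico_gcd_eval_eq_one f (pow_ne_zero k hp.ne_zero) 1 0
  simp only [coprime_iff] at h
  rw [← one_mul (unitValueCount f (p ^ k)), ← h, ← card_Ico_gcd_eval_eq_one f hp.ne_zero _ 0]
  push_cast at split ⊢
  rw [one_mul, split]

theorem unitValueCount_eq_mul_prod (f : ℤ[X]) {d : ℕ} (hd : d ≠ 0) :
    (unitValueCount f d : ℝ) = d * ∏ p ∈ d.primeFactors, (unitValueCount f p : ℝ) / p := by
  induction d using Nat.recOnPosPrimePosCoprime with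
  | zero => exact absurd rfl hd
  | one =>
    have : unitValueCount f 1 = 1 :=
      Nat.card_eq_one_iff_unique.2 ⟨inferInstance, ⟨⟨0, isUnit_of_subsingleton _⟩⟩⟩
    simp [this]
  | prime_pow p k hp hk =>
    have hp0 : (p : ℝ) ≠ 0 := by exact_mod_cast hp.ne_zero
    rw [unitValueCount_prime_pow f hp hk.ne', Nat.primeFactors_prime_pow hk.ne' hp,
      prod_singleton, ← pow_sub_one_mul hk.ne' p]
    push_cast
    field_simp
  | coprime x y hx hy hxy ihx ihy =>
    rw [unitValueCount_mul f hxy, hxy.primeFactors_mul, prod_union hxy.disjoint_primeFactors]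
    push_cast
    rw [ihx (by lia), ihy (by lia)]
    ring

theorem unitValueCount_X {d : ℕ} (hd : d ≠ 0) : unitValueCount X d = d.totient := by
  have := NeZero.mk hd
  rw [unitValueCount, ← ZMod.card_units_eq_totient, ← Nat.card_eq_fintype_card]
  simp only [aeval_X]
  exact Nat.card_congr Submonoid.unitsTypeEquivIsUnitSubmonoid.symm.toEquiv

theorem unitValueCount_add_card_le (f : ℤ[X]) {p : ℕ} [Fact p.Prime] {S : Finset (ZMod p)}
    (hS : ∀ t ∈ S, aeval t f = 0) : unitValueCount f p + #S ≤ p := by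
  classical
  have disj : Disjoint ({t | IsUnit (aeval t f)} : Finset (ZMod p)) S :=
    disjoint_left.2 fun t ht hts => (mem_filter.1 ht).2.ne_zero (hS t hts)
  rw [unitValueCount, Nat.card_eq_fintype_card, Fintype.card_subtype, ← card_union_of_disjoint disj]
  exact (card_le_univ _).trans_eq (ZMod.card p)

/-- The product of the linear forms `a + m t` and `b + n t` in the variable `t`. -/
noncomputable def linearProd (a m b n : ℤ) : ℤ[X] :=
  (C a + C m * X) * (C b + C n * X)

theorem eval_linearProd (a m b n t : ℤ) :
    (linearProd a m b n).eval t = (a + m * t) * (b + n * t) := by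
  simp [linearProd]

theorem unitValueCount_linearProd_prime_le (a b : ℤ) {m n p : ℕ} (hmn : m.Coprime n)
    (hp : p.Prime) :
    (unitValueCount (linearProd a m b n) p : ℝ) / p ≤
      if (p : ℤ) ∣ m * n * (a * n - b * m) then 1 - (p : ℝ)⁻¹ else (1 - (p : ℝ)⁻¹) ^ 2 := by
  have := Fact.mk hp
  have hp0 : (0 : ℝ) < p := by exact_mod_cast hp.pos
  have eval (t : ZMod p) : aeval t (linearProd a m b n) = (a + m * t) * (b + n * t) := by
    simp [linearProd]
  have root_left (hm : (m : ZMod p) ≠ 0) : aeval (-a / m : ZMod p) (linearProd a m b n) = 0 := by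
    rw [eval, mul_div_cancel₀ _ hm, add_neg_cancel, zero_mul]
  have root_right (hn : (n : ZMod p) ≠ 0) : aeval (-b / n : ZMod p) (linearProd a m b n) = 0 := by
    rw [eval, mul_div_cancel₀ _ hn, add_neg_cancel, mul_zero]
  have bound (S : Finset (ZMod p)) (hS : ∀ t ∈ S, aeval t (linearProd a m b n) = 0) :
      (unitValueCount (linearProd a m b n) p : ℝ) / p ≤ 1 - #S * (p : ℝ)⁻¹ := by
    have h : (unitValueCount (linearProd a m b n) p + #S : ℝ) ≤ p := by
      exact_mod_cast unitValueCount_add_card_le _ hS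
    rw [div_le_iff₀ hp0, sub_mul, mul_assoc, inv_mul_cancel₀ hp0.ne']
    linarith
  split_ifs with hdvd
  · obtain ⟨t, ht⟩ : ∃ t : ZMod p, aeval t (linearProd a m b n) = 0 := by
      by_cases hm : (m : ZMod p) = 0
      · refine ⟨_, root_right fun hn => hp.one_lt.ne' ?_⟩
        rw [ZMod.natCast_eq_zero_iff] at hm hn
        exact Nat.eq_one_of_dvd_coprimes hmn hm hn
      · exact ⟨_, root_left hm⟩
    simpa using bound {t} (by simpa using ht)
  · simp only [← ZMod.intCast_zmod_eq_zero_iff_dvd, Int.cast_mul, Int.cast_sub, Int.cast_natCast,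
      mul_eq_zero, not_or] at hdvd
    obtain ⟨⟨hm, hn⟩, hdet⟩ := hdvd
    have distinct : (-a / m : ZMod p) ≠ -b / n := fun h => hdet <| by
      rw [div_eq_div_iff hm hn] at h
      linear_combination -h
    have h := bound {(-a / m : ZMod p), (-b / n : ZMod p)} fun t ht => by
      rcases mem_insert.1 ht with rfl | ht
      · exact root_left hm
      · exact mem_singleton.1 ht ▸ root_right hn
    rw [card_pair distinct] at h
    push_cast at h
    linarith [sq_nonneg (p : ℝ)⁻¹]

theorem prod_primeFactors_eq_prod_ite {A M : ℕ} (hA : A ∣ M) (hM : M ≠ 0) (g : ℕ → ℝ) :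
    ∏ p ∈ A.primeFactors, g p = ∏ p ∈ M.primeFactors, if p ∣ A then g p else 1 := by
  rw [← prod_filter]
  refine prod_congr ?_ fun _ _ => rfl
  ext p
  simp only [mem_filter, Nat.mem_primeFactors]
  exact ⟨fun ⟨hp, hpA, _⟩ => ⟨⟨hp, hpA.trans hA, hM⟩, hpA⟩,
    fun ⟨⟨hp, _, _⟩, hpA⟩ => ⟨hp, hpA, ne_zero_of_dvd_ne_zero hM hA⟩⟩

theorem prod_local_factor_mul_le {d m n k : ℕ} (hd : d ≠ 0) (hm : m ≠ 0) (hn : n ≠ 0) (hk : k ≠ 0)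
    (hmn : m.Coprime n) (hkmn : k.Coprime (m * n)) :
    (∏ p ∈ d.primeFactors, if p ∣ m * n * k then 1 - (p : ℝ)⁻¹ else (1 - (p : ℝ)⁻¹) ^ 2) *
      ((((m * n : ℕ).totient : ℝ) / (m * n : ℕ)) * ((k.totient : ℝ) / k)) ≤
    (((d * m : ℕ).totient : ℝ) / (d * m : ℕ)) * (((d * n : ℕ).totient : ℝ) / (d * n : ℕ)) := by
  have hM : d * m * n * k ≠ 0 := by positivity
  rw [totient_div_self_eq_prod (mul_ne_zero hm hn), totient_div_self_eq_prod hk,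
    totient_div_self_eq_prod (mul_ne_zero hd hm), totient_div_self_eq_prod (mul_ne_zero hd hn),
    prod_primeFactors_eq_prod_ite (M := d * m * n * k) (A := d) ⟨m * n * k, by ring⟩ hM,
    prod_primeFactors_eq_prod_ite (M := d * m * n * k) (A := m * n) ⟨d * k, by ring⟩ hM,
    prod_primeFactors_eq_prod_ite (M := d * m * n * k) (A := k) ⟨d * m * n, by ring⟩ hM,
    prod_primeFactors_eq_prod_ite (M := d * m * n * k) (A := d * m) ⟨n * k, by ring⟩ hM,
    prod_primeFactors_eq_prod_ite (M := d * m * n * k) (A := d * n) ⟨m * k, by ring⟩ hM,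
    ← prod_mul_distrib, ← prod_mul_distrib, ← prod_mul_distrib]
  refine prod_le_prod (fun p hp => ?_) fun p hp => ?_
  · have hu := one_sub_inv_prime_pos (Nat.prime_of_mem_primeFactors hp)
    split_ifs <;> positivity
  · have hpp := Nat.prime_of_mem_primeFactors hp
    have hu := one_sub_inv_prime_pos hpp
    have hu1 : 1 - (p : ℝ)⁻¹ ≤ 1 := sub_le_self _ (by positivity)
    have not_dvd_both : ¬(p ∣ m ∧ p ∣ n) := fun h =>
      hpp.one_lt.ne' (Nat.eq_one_of_dvd_coprimes hmn h.1 h.2)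
    have not_dvd_det : ¬(p ∣ k ∧ p ∣ m * n) := fun h =>
      hpp.one_lt.ne' (Nat.eq_one_of_dvd_coprimes hkmn h.1 h.2)
    simp only [hpp.dvd_mul] at not_dvd_det ⊢
    generalize 1 - (p : ℝ)⁻¹ = u at hu hu1
    by_cases hd : p ∣ d <;> by_cases hm : p ∣ m <;> by_cases hn : p ∣ n <;>
      by_cases hk : p ∣ k <;> (simp_all; try nlinarith)

theorem unitValueCount_linearProd_mul_le {a b k : ℤ} {d m n : ℕ} (hd : d ≠ 0) (hm : m ≠ 0)
    (hn : n ≠ 0) (hmn : m.Coprime n) (hk : k ≠ 0) (hkmn : k.natAbs.Coprime (m * n))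
    (hdet : a * n - b * m = k) :
    (unitValueCount (linearProd a m b n) d : ℝ) * (((m * n : ℕ).totient : ℝ) / (m * n : ℕ)) ≤
      d * ((((d * m : ℕ).totient : ℝ) / (d * m : ℕ)) * (((d * n : ℕ).totient : ℝ) / (d * n : ℕ)))
        * ((k.natAbs : ℝ) / k.natAbs.totient) := by
  have hk' : k.natAbs ≠ 0 := Int.natAbs_ne_zero.2 hk
  have totient_pos := totient_div_self_pos hk'
  have dvd_iff (p : ℕ) : (p : ℤ) ∣ m * n * k ↔ p ∣ m * n * k.natAbs := by
    rw [Int.natCast_dvd, Int.natAbs_mul]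
    norm_cast
  have prime_bound (p : ℕ) (hp : p ∈ d.primeFactors) :
      (unitValueCount (linearProd a m b n) p : ℝ) / p ≤
        if p ∣ m * n * k.natAbs then 1 - (p : ℝ)⁻¹ else (1 - (p : ℝ)⁻¹) ^ 2 := by
    simpa only [hdet, dvd_iff] using
      unitValueCount_linearProd_prime_le a b hmn (Nat.prime_of_mem_primeFactors hp)
  rw [unitValueCount_eq_mul_prod _ hd, ← inv_div (k.natAbs.totient : ℝ), ← div_eq_mul_inv,
    le_div_iff₀ totient_pos, mul_assoc, mul_assoc]
  refine mul_le_mul_of_nonneg_left ?_ (Nat.cast_nonneg d)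
  refine (mul_le_mul_of_nonneg_right
    (prod_le_prod (fun p _ => by positivity) prime_bound) (by positivity)).trans ?_
  exact prod_local_factor_mul_le hd hm hn hk' hmn hkmn

end UnitValues

section CoprimeNumerators

open Finset Polynomial

/-- The integers `a` coprime to `q` for which `(a + γ) / q` lies in `[-1, 2]`. A numerator outside
this range cannot contribute to `coprimeApproxSet γ ψ q` when `ψ q < q`. -/
noncomputable def coprimeNumerators (γ : ℝ) (q : ℕ) : Finset ℤ :=
  {a ∈ Icc ⌈-(q : ℝ) - γ⌉ ⌊2 * (q : ℝ) - γ⌋ | Int.gcd a q = 1}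

theorem mem_coprimeNumerators {γ : ℝ} {q : ℕ} {a : ℤ} :
    a ∈ coprimeNumerators γ q ↔
      (-(q : ℝ) - γ ≤ a ∧ (a : ℝ) ≤ 2 * q - γ) ∧ Int.gcd a q = 1 := by
  rw [coprimeNumerators, mem_filter, mem_Icc, Int.ceil_le, Int.le_floor]

theorem card_coprimeNumerators_le (γ : ℝ) {q : ℕ} (hq : q ≠ 0) :
    #(coprimeNumerators γ q) ≤ 4 * q.totient := by
  rw [← unitValueCount_X hq, ← card_Ico_gcd_eval_eq_one X hq 4 ⌈-(q : ℝ) - γ⌉]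
  refine card_le_card fun a ha => ?_
  obtain ⟨⟨lower, upper⟩, hgcd⟩ := mem_coprimeNumerators.1 ha
  have hq0 : (0 : ℝ) < q := by exact_mod_cast Nat.pos_of_ne_zero hq
  have : (a : ℝ) < ⌈-(q : ℝ) - γ⌉ + 4 * q := by linarith [Int.le_ceil (-(q : ℝ) - γ)]
  rw [mem_filter, mem_Ico, eval_X]
  exact ⟨⟨Int.ceil_le.2 lower, by exact_mod_cast this⟩, hgcd⟩

theorem card_filter_det_eq_le (γ : ℝ) {d m n : ℕ} (hd : d ≠ 0) (hm : m ≠ 0) (hmn : m.Coprime n)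
    {a b : ℤ} (ha : a ∈ coprimeNumerators γ (d * m)) :
    #{x ∈ coprimeNumerators γ (d * m) ×ˢ coprimeNumerators γ (d * n) |
      x.1 * n - x.2 * m = a * n - b * m} ≤ 7 * unitValueCount (linearProd a m b n) d := by
  rw [← card_Ico_gcd_eval_eq_one _ hd 7 (-3 * d)]
  refine (card_le_card fun x hx => ?_).trans
    (card_image_le (f := fun t : ℤ => (a + m * t, b + n * t)))
  obtain ⟨hx, hdet⟩ := mem_filter.1 hx
  obtain ⟨⟨lower, upper⟩, hgcd₁⟩ := mem_coprimeNumerators.1 (mem_product.1 hx).1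
  obtain ⟨⟨lower', upper'⟩, -⟩ := mem_coprimeNumerators.1 ha
  have hgcd₂ := (mem_coprimeNumerators.1 (mem_product.1 hx).2).2
  have hm0 : (m : ℤ) ≠ 0 := by exact_mod_cast hm
  have hmpos : (0 : ℝ) < m := by exact_mod_cast Nat.pos_of_ne_zero hm
  obtain ⟨t, ht⟩ : (m : ℤ) ∣ x.1 - a :=
    (Nat.isCoprime_iff_coprime.2 hmn).dvd_of_dvd_mul_right
      ⟨x.2 - b, by linear_combination hdet⟩
  have fst_eq : x.1 = a + m * t := by linear_combination ht
  have snd_eq : x.2 = b + n * t := mul_left_cancel₀ hm0 <| by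
    linear_combination n * ht - hdet
  have range : -3 * (d : ℝ) ≤ t ∧ (t : ℝ) ≤ 3 * d := by
    have : (x.1 : ℝ) = a + m * t := by exact_mod_cast fst_eq
    push_cast at lower upper lower' upper'
    constructor <;> refine le_of_mul_le_mul_left ?_ hmpos <;> linarith
  refine mem_image.2 ⟨t, mem_filter.2 ⟨mem_Ico.2 ⟨by exact_mod_cast range.1, ?_⟩, ?_⟩,
    Prod.ext fst_eq.symm snd_eq.symm⟩
  · have : t ≤ 3 * d := by exact_mod_cast range.2
    push_cast
    lia
  · rw [eval_linearProd, ← fst_eq, ← snd_eq, ← Int.isCoprime_iff_gcd_eq_one]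
    rw [← Int.isCoprime_iff_gcd_eq_one, Nat.cast_mul] at hgcd₁ hgcd₂
    exact hgcd₁.of_mul_right_left.mul_left hgcd₂.of_mul_right_left

theorem card_filter_det_mul_le (γ : ℝ) {d m n : ℕ} (hd : d ≠ 0) (hm : m ≠ 0) (hn : n ≠ 0)
    (hmn : m.Coprime n) {k : ℤ} (hk : k ≠ 0) (hkmn : k.natAbs.Coprime (m * n)) :
    (#{x ∈ coprimeNumerators γ (d * m) ×ˢ coprimeNumerators γ (d * n) | x.1 * n - x.2 * m = k} : ℝ)
      * (((m * n : ℕ).totient : ℝ) / (m * n : ℕ)) ≤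
    7 * (d * ((((d * m : ℕ).totient : ℝ) / (d * m : ℕ)) * (((d * n : ℕ).totient : ℝ) / (d * n : ℕ)))
      * ((k.natAbs : ℝ) / k.natAbs.totient)) := by
  rcases {x ∈ coprimeNumerators γ (d * m) ×ˢ coprimeNumerators γ (d * n) |
    x.1 * n - x.2 * m = k}.eq_empty_or_nonempty with empty | ⟨⟨a, b⟩, hab⟩
  · rw [empty, card_empty, Nat.cast_zero, zero_mul]
    positivity
  · obtain ⟨mem, rfl⟩ := mem_filter.1 hab
    have ha := (mem_product.1 mem).1
    have h : (#{x ∈ coprimeNumerators γ (d * m) ×ˢ coprimeNumerators γ (d * n) |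
        x.1 * n - x.2 * m = a * n - b * m} : ℝ) ≤ 7 * unitValueCount (linearProd a m b n) d := by
      exact_mod_cast card_filter_det_eq_le γ hd hm hmn ha
    refine (mul_le_mul_of_nonneg_right h (by positivity)).trans ?_
    rw [mul_assoc]
    exact mul_le_mul_of_nonneg_left
      (unitValueCount_linearProd_mul_le hd hm hn hmn hk hkmn rfl) (by norm_num)

theorem sum_natAbs_le_two_mul_sum (N : ℕ) (p : ℕ → Prop) [DecidablePred p] {g : ℕ → ℝ}
    (hg : ∀ j, 0 ≤ g j) :
    ∑ k ∈ Icc (-(N : ℤ)) N with k ≠ 0 ∧ p k.natAbs, g k.natAbs ≤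
      2 * ∑ j ∈ Ioc 0 N with p j, g j := by
  set K := {k ∈ Icc (-(N : ℤ)) N | k ≠ 0 ∧ p k.natAbs} with hK
  have maps : ∀ k ∈ K, k.natAbs ∈ {j ∈ Ioc 0 N | p j} := by
    intro k hk
    simp only [hK, mem_filter, mem_Icc, mem_Ioc] at hk ⊢
    exact ⟨by lia, hk.2.2⟩
  rw [← sum_fiberwise_of_maps_to maps, mul_sum]
  refine sum_le_sum fun j _ => ?_
  have fiber : {k ∈ K | k.natAbs = j} ⊆ {(j : ℤ), -(j : ℤ)} := by
    intro k hk
    have := (mem_filter.1 hk).2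
    rw [mem_insert, mem_singleton]
    lia
  rw [sum_congr rfl fun k hk => by rw [(mem_filter.1 hk).2], sum_const, nsmul_eq_mul]
  exact mul_le_mul_of_nonneg_right (by exact_mod_cast (card_le_card fiber).trans card_le_two) (hg j)

theorem natAbs_det_coprime {a b : ℤ} {d m n : ℕ} (hmn : m.Coprime n)
    (ha : Int.gcd a (d * m : ℕ) = 1) (hb : Int.gcd b (d * n : ℕ) = 1) :
    (a * n - b * m).natAbs.Coprime (m * n) := by
  rw [← Int.isCoprime_iff_gcd_eq_one, Nat.cast_mul] at ha hb
  have hco : IsCoprime (m : ℤ) n := Nat.isCoprime_iff_coprime.2 hmn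
  have hdet_m : IsCoprime (a * n - b * m) m :=
    IsCoprime.sub_mul_right_left_iff.2 (ha.of_mul_right_right.mul_left hco.symm)
  have hdet_n : IsCoprime (a * n - b * m) n :=
    IsCoprime.mul_sub_right_left_iff.2 (hb.of_mul_right_right.mul_left hco)
  simpa [Int.natAbs_mul] using Int.isCoprime_iff_nat_coprime.1 (hdet_m.mul_right hdet_n)

theorem card_filter_natAbs_det_le (γ : ℝ) {d m n N : ℕ} (hd : d ≠ 0) (hm : m ≠ 0) (hn : n ≠ 0)
    (hmn : m.Coprime n) (hN : m + n ≤ N) :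
    (#{x ∈ coprimeNumerators γ (d * m) ×ˢ coprimeNumerators γ (d * n) |
        (x.1 * n - x.2 * m : ℤ).natAbs ∈ Ioc 0 N} : ℝ) ≤
      6720 * (d * N) *
        (((d * m : ℕ).totient : ℝ) / (d * m : ℕ) * (((d * n : ℕ).totient : ℝ) / (d * n : ℕ))) := by
  set U := (((d * m : ℕ).totient : ℝ) / (d * m : ℕ)) * (((d * n : ℕ).totient : ℝ) / (d * n : ℕ))
  set V := ((m * n : ℕ).totient : ℝ) / (m * n : ℕ)
  set S := {x ∈ coprimeNumerators γ (d * m) ×ˢ coprimeNumerators γ (d * n) |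
        (x.1 * n - x.2 * m : ℤ).natAbs ∈ Ioc 0 N}
  set K := {k ∈ Icc (-(N : ℤ)) N | k ≠ 0 ∧ k.natAbs.Coprime (m * n)}
  have maps : ∀ x ∈ S, x.1 * n - x.2 * m ∈ K := by
    intro x hx
    obtain ⟨hx, hdet⟩ := mem_filter.1 hx
    obtain ⟨hx₁, hx₂⟩ := mem_product.1 hx
    obtain ⟨hne, hle⟩ := mem_Ioc.1 hdet
    refine mem_filter.2 ⟨mem_Icc.2 (by lia), by lia, ?_⟩
    exact natAbs_det_coprime hmn (mem_coprimeNumerators.1 hx₁).2 (mem_coprimeNumerators.1 hx₂).2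
  have fiber_le : ∀ k ∈ K, (#{x ∈ S | x.1 * n - x.2 * m = k} : ℝ) * V ≤
      7 * (d * U * ((k.natAbs : ℝ) / k.natAbs.totient)) := by
    intro k hk
    obtain ⟨-, hk0, hkmn⟩ := mem_filter.1 hk
    refine le_trans ?_ (card_filter_det_mul_le γ hd hm hn hmn hk0 hkmn)
    gcongr
    exact filter_subset _ _
  have sum_le : ∑ k ∈ K, ((k.natAbs : ℝ) / k.natAbs.totient) ≤ 2 * (480 * N * V) := by
    refine (sum_natAbs_le_two_mul_sum N (fun j => j.Coprime (m * n))
      (g := fun j => (j : ℝ) / j.totient) fun j => by positivity).trans ?_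
    gcongr
    exact sum_coprime_self_div_totient_le (by lia) (mul_ne_zero hm hn) (by nlinarith)
  refine le_of_mul_le_mul_right ?_ (totient_div_self_pos (mul_ne_zero hm hn))
  calc (#S : ℝ) * V = ∑ k ∈ K, (#{x ∈ S | x.1 * n - x.2 * m = k} : ℝ) * V := by
        rw [card_eq_sum_card_fiberwise maps, Nat.cast_sum, sum_mul]
    _ ≤ ∑ k ∈ K, 7 * (d * U * ((k.natAbs : ℝ) / k.natAbs.totient)) := sum_le_sum fiber_le
    _ = 7 * (d * U) * ∑ k ∈ K, ((k.natAbs : ℝ) / k.natAbs.totient) := by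
        rw [mul_sum]
        exact sum_congr rfl fun _ _ => by ring
    _ ≤ 7 * (d * U) * (2 * (480 * N * V)) := by gcongr
    _ = 6720 * (d * N) * U * V := by ring

/-- The pairs `(a, b)` of coprime numerators for `q` and `r` with `a / q ≠ b / r` for which
`(a + γ) / q` and `(b + γ) / r` are at distance at most `ρ / (q r)`; denominators are cleared. -/
noncomputable def closePairs (γ : ℝ) (q r : ℕ) (ρ : ℝ) : Finset (ℤ × ℤ) :=
  {x ∈ coprimeNumerators γ q ×ˢ coprimeNumerators γ r |
    x.1 * r ≠ x.2 * q ∧ |((x.1 : ℝ) + γ) * r - (x.2 + γ) * q| ≤ ρ}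

theorem abs_le_of_abs_add_mul_sub_le {γ δ m n L y : ℝ} (hδ : 0 < δ) (hm : 0 ≤ m) (hn : 0 ≤ n)
    (hL : δ * (m + n) ≤ L) (h : |y + γ * (n - m)| ≤ L) : |y| ≤ (1 + |γ| / δ) * L := by
  have gap : |n - m| ≤ L / δ := by
    rw [le_div_iff₀' hδ]
    exact (mul_le_mul_of_nonneg_left (abs_le.2 ⟨by linarith, by linarith⟩) hδ.le).trans hL
  calc |y| = |(y + γ * (n - m)) - γ * (n - m)| := by rw [add_sub_cancel_right]
    _ ≤ |y + γ * (n - m)| + |γ| * |n - m| := (abs_sub _ _).trans_eq (by rw [abs_mul])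
    _ ≤ L + |γ| * (L / δ) := by gcongr
    _ = (1 + |γ| / δ) * L := by ring

theorem closePairs_subset (γ : ℝ) {δ κ L : ℝ} {d m n : ℕ} (hδ : 0 < δ) (hd : d ≠ 0)
    (hL : δ * (m + n) ≤ L) (hκ : 1 + |γ| / δ ≤ κ) :
    closePairs γ (d * m) (d * n) (d * L) ⊆
      {x ∈ coprimeNumerators γ (d * m) ×ˢ coprimeNumerators γ (d * n) |
        (x.1 * n - x.2 * m : ℤ).natAbs ∈ Ioc 0 ⌊κ * L⌋₊} := by
  have hd0 : (0 : ℝ) < d := by exact_mod_cast Nat.pos_of_ne_zero hd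
  have hL0 : 0 ≤ L := le_trans (by positivity) hL
  intro x hx
  obtain ⟨hx, hne, hclose⟩ := mem_filter.1 hx
  refine mem_filter.2 ⟨hx, mem_Ioc.2 ⟨Int.natAbs_pos.2 fun h => hne ?_, Nat.le_floor ?_⟩⟩
  · push_cast
    linear_combination (d : ℤ) * h
  · have factor : ((x.1 : ℝ) + γ) * (d * n : ℕ) - (x.2 + γ) * (d * m : ℕ) =
        d * ((x.1 * n - x.2 * m) + γ * (n - m)) := by push_cast; ring
    rw [factor, abs_mul, abs_of_pos hd0] at hclose
    have := abs_le_of_abs_add_mul_sub_le hδ (Nat.cast_nonneg m) (Nat.cast_nonneg n) hL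
      (le_of_mul_le_mul_left hclose hd0)
    rw [Nat.cast_natAbs]
    push_cast
    exact this.trans (mul_le_mul_of_nonneg_right hκ hL0)

theorem card_closePairs_le (γ : ℝ) {δ ρ : ℝ} {q r : ℕ} (hδ : 0 < δ) (hq : q ≠ 0) (hr : r ≠ 0)
    (hρ : δ * (q + r) ≤ ρ) :
    (#(closePairs γ q r ρ) : ℝ) ≤ 6720 * (1 + (|γ| + 1) / δ) * ρ *
      ((q.totient : ℝ) / q * ((r.totient : ℝ) / r)) := by
  obtain ⟨d, m, n, hmn, rfl, rfl⟩ : ∃ d m n : ℕ, m.Coprime n ∧ q = d * m ∧ r = d * n := by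
    obtain ⟨m, n, hmn, hm, hn⟩ := Nat.exists_coprime q r
    exact ⟨q.gcd r, m, n, hmn, hm.trans (mul_comm _ _), hn.trans (mul_comm _ _)⟩
  obtain ⟨hd, hm⟩ := mul_ne_zero_iff.1 hq
  have hn := (mul_ne_zero_iff.1 hr).2
  have hd0 : (0 : ℝ) < d := by exact_mod_cast Nat.pos_of_ne_zero hd
  set κ := 1 + (|γ| + 1) / δ with hκ
  have κ_eq : κ = 1 + |γ| / δ + 1 / δ := by rw [hκ]; ring
  obtain ⟨L, rfl⟩ : ∃ L, ρ = d * L := ⟨ρ / d, (mul_div_cancel₀ _ hd0.ne').symm⟩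
  have hL : δ * (m + n) ≤ L := by
    refine le_of_mul_le_mul_left (le_trans (le_of_eq ?_) hρ) hd0
    push_cast
    ring
  have hL0 : 0 ≤ L := le_trans (by positivity) hL
  have sum_le : (m + n : ℝ) ≤ κ * L := by
    calc (m + n : ℝ) ≤ L / δ := (le_div_iff₀' hδ).2 hL
      _ ≤ (1 + |γ| / δ) * L + L / δ := le_add_of_nonneg_left (by positivity)
      _ = κ * L := by rw [κ_eq]; ring
  have subset := closePairs_subset γ hδ hd hL (κ := κ) <| by
    rw [κ_eq]
    exact le_add_of_nonneg_right (by positivity)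
  calc (#(closePairs γ (d * m) (d * n) (d * L)) : ℝ)
      ≤ 6720 * (d * ⌊κ * L⌋₊) * ((((d * m : ℕ).totient : ℝ) / (d * m : ℕ)) *
          (((d * n : ℕ).totient : ℝ) / (d * n : ℕ))) :=
        (Nat.cast_le.2 (card_le_card subset)).trans <| card_filter_natAbs_det_le γ hd hm hn hmn <|
          Nat.le_floor (by exact_mod_cast sum_le)
    _ ≤ 6720 * (d * (κ * L)) * ((((d * m : ℕ).totient : ℝ) / (d * m : ℕ)) *
          (((d * n : ℕ).totient : ℝ) / (d * n : ℕ))) := by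
        gcongr
        exact Nat.floor_le (by positivity)
    _ = _ := by ring

end CoprimeNumerators

section IntervalSieve

open Finset

theorem abs_card_Icc_sub_le {x y : ℝ} (hxy : x ≤ y) : |(#(Icc ⌈x⌉ ⌊y⌋) : ℝ) - (y - x)| ≤ 1 := by
  have nonneg : 0 ≤ ⌊y⌋ + 1 - ⌈x⌉ := by
    rw [sub_nonneg, Int.ceil_le]
    push_cast
    exact hxy.trans (Int.lt_floor_add_one y).le
  have card : (#(Icc ⌈x⌉ ⌊y⌋) : ℝ) = ⌊y⌋ + 1 - ⌈x⌉ := by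
    rw [Int.card_Icc]
    exact_mod_cast Int.toNat_of_nonneg nonneg
  rw [card, abs_le]
  constructor <;>
    linarith [Int.floor_le y, Int.lt_floor_add_one y, Int.le_ceil x, Int.ceil_lt_add_one x]

theorem card_filter_not_dvd_eq_add {p : ℕ} (hp : p.Prime) {s : Finset ℕ} (hs : ∀ r ∈ s, r.Prime)
    (hps : p ∉ s) (x y : ℝ) :
    #{a ∈ Icc ⌈x⌉ ⌊y⌋ | ∀ r ∈ s, ¬(r : ℤ) ∣ a} =
      #{a ∈ Icc ⌈x⌉ ⌊y⌋ | ∀ r ∈ insert p s, ¬(r : ℤ) ∣ a} +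
        #{a ∈ Icc ⌈x / p⌉ ⌊y / p⌋ | ∀ r ∈ s, ¬(r : ℤ) ∣ a} := by
  have hp0 : (0 : ℝ) < p := by exact_mod_cast hp.pos
  have mem_scaled (a : ℤ) :
      (p : ℤ) * a ∈ Icc ⌈x⌉ ⌊y⌋ ↔ a ∈ Icc ⌈x / p⌉ ⌊y / p⌋ := by
    simp only [mem_Icc, Int.ceil_le, Int.le_floor, div_le_iff₀' hp0, le_div_iff₀' hp0]
    push_cast
    rfl
  have dvd_scaled (r : ℕ) (hr : r ∈ s) (a : ℤ) : (r : ℤ) ∣ p * a ↔ (r : ℤ) ∣ a := by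
    have : IsCoprime (r : ℤ) p := by
      rw [Nat.isCoprime_iff_coprime, Nat.coprime_primes (hs r hr) hp]
      exact fun h => hps (h ▸ hr)
    exact ⟨this.dvd_of_dvd_mul_left, fun h => h.mul_left _⟩
  rw [← card_filter_add_card_filter_not (fun a : ℤ => ¬(p : ℤ) ∣ a), filter_filter, filter_filter]
  congr 1
  · simp only [forall_mem_insert, and_comm]
  · symm
    refine card_bij (fun a _ => p * a) (fun a ha => ?_)
      (fun a _ b _ h => mul_left_cancel₀ (by exact_mod_cast hp.ne_zero) h) fun b hb => ?_
    · obtain ⟨hIcc, hdvd⟩ := mem_filter.1 ha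
      exact mem_filter.2 ⟨(mem_scaled a).2 hIcc,
        fun r hr h => hdvd r hr ((dvd_scaled r hr a).1 h), not_not.2 (dvd_mul_right _ _)⟩
    · obtain ⟨hIcc, hdvd, hpb⟩ := mem_filter.1 hb
      obtain ⟨a, rfl⟩ := not_not.1 hpb
      exact ⟨a, mem_filter.2 ⟨(mem_scaled a).1 hIcc,
        fun r hr h => hdvd r hr ((dvd_scaled r hr a).2 h)⟩, rfl⟩

theorem abs_card_filter_not_dvd_sub_le {s : Finset ℕ} (hs : ∀ p ∈ s, p.Prime) {x y : ℝ}
    (hxy : x ≤ y) :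
    |(#{a ∈ Icc ⌈x⌉ ⌊y⌋ | ∀ p ∈ s, ¬(p : ℤ) ∣ a} : ℝ) - (y - x) * ∏ p ∈ s, (1 - (p : ℝ)⁻¹)| ≤
      2 ^ #s := by
  induction s using Finset.induction_on generalizing x y with
  | empty => simpa using abs_card_Icc_sub_le hxy
  | insert p s hps ih =>
    obtain ⟨hp, hs⟩ := (forall_mem_insert ..).1 hs
    have hp0 : (0 : ℝ) < p := by exact_mod_cast hp.pos
    have whole := ih hs hxy
    have multiples := ih hs (div_le_div_of_nonneg_right hxy hp0.le)
    rw [card_filter_not_dvd_eq_add hp hs hps, Nat.cast_add] at whole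
    rw [prod_insert hps, card_insert_of_notMem hps, pow_succ]
    have main_term (M : ℝ) :
        (y - x) * ((1 - (p : ℝ)⁻¹) * M) = (y - x) * M - (y / p - x / p) * M := by
      field_simp
    rw [main_term]
    rw [abs_le] at whole multiples ⊢
    constructor <;> linarith

theorem int_gcd_eq_one_iff {q : ℕ} (hq : q ≠ 0) (a : ℤ) :
    Int.gcd a q = 1 ↔ ∀ p ∈ q.primeFactors, ¬(p : ℤ) ∣ a := by
  have : ¬a.natAbs.Coprime q ↔ ∃ p, p.Prime ∧ p ∣ a.natAbs ∧ p ∣ q :=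
    Nat.Prime.not_coprime_iff_dvd
  rw [Int.gcd_def, Int.natAbs_natCast, ← Nat.coprime_iff_gcd_eq_one, ← not_iff_not, this]
  simp only [Nat.mem_primeFactors, Int.natCast_dvd]
  grind

theorem abs_card_coprime_Icc_sub_le {q : ℕ} (hq : q ≠ 0) {x y : ℝ} (hxy : x ≤ y) :
    |(#{a ∈ Icc ⌈x⌉ ⌊y⌋ | Int.gcd a q = 1} : ℝ) - (y - x) * (q.totient / q)| ≤
      2 ^ #q.primeFactors := by
  simpa only [int_gcd_eq_one_iff hq, totient_div_self_eq_prod hq] using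
    abs_card_filter_not_dvd_sub_le (fun p hp => Nat.prime_of_mem_primeFactors hp) hxy

theorem eventually_le_card_coprime_Icc {ℓ : ℝ} (hℓ : 0 < ℓ) :
    ∀ᶠ q : ℕ in atTop, ∀ x y : ℝ, ℓ * q ≤ y - x →
      (y - x) * (q.totient / q) / 2 ≤ #{a ∈ Icc ⌈x⌉ ⌊y⌋ | Int.gcd a q = 1} := by
  have totient_large := (tendsto_natCast_atTop_atTop.comp
    tendsto_totient_atTop).eventually_ge_atTop (64 / ℓ ^ 2)
  filter_upwards [totient_large, eventually_ne_atTop 0] with q hφ hq x y hxy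
  have hq0 : (0 : ℝ) < q := by exact_mod_cast Nat.pos_of_ne_zero hq
  have h4 : (4 : ℝ) ^ #q.primeFactors ≤ 16 * q.totient := by
    exact_mod_cast four_pow_card_primeFactors_le hq
  have error_le : (2 : ℝ) ^ #q.primeFactors ≤ ℓ * q.totient / 2 := by
    have sq : ((2 : ℝ) ^ #q.primeFactors) ^ 2 = 4 ^ #q.primeFactors := by
      rw [← pow_mul, mul_comm, pow_mul]
      norm_num
    rw [Function.comp_apply, div_le_iff₀ (by positivity)] at hφ
    refine le_of_sq_le_sq (sq.trans_le (h4.trans ?_)) (by positivity)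
    nlinarith [(Nat.cast_nonneg q.totient : (0 : ℝ) ≤ q.totient)]
  have main_ge : ℓ * q.totient ≤ (y - x) * (q.totient / q) :=
    calc ℓ * q.totient = ℓ * q * (q.totient / q) := by field_simp
      _ ≤ (y - x) * (q.totient / q) := by gcongr
  have hxy' : x ≤ y := sub_nonneg.1 (le_trans (by positivity) hxy)
  linarith [(abs_le.1 (abs_card_coprime_Icc_sub_le hq hxy')).1]

end IntervalSieve

section ApproxCount

open Finset

theorem volume_closedBall_inter_closedBall_le {z z' ρ ρ' : ℝ} (hρ : 0 ≤ ρ) (hρ' : 0 ≤ ρ') :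
    volume.real (Metric.closedBall z ρ ∩ Metric.closedBall z' ρ') ≤ 2 * min ρ ρ' := by
  rw [mul_min_of_nonneg _ _ zero_le_two, ← Real.volume_real_closedBall hρ,
    ← Real.volume_real_closedBall hρ']
  exact le_min (measureReal_mono Set.inter_subset_left measure_closedBall_lt_top.ne)
    (measureReal_mono Set.inter_subset_right measure_closedBall_lt_top.ne)

theorem min_le_volume_closedBall_inter_closedBall {z z' ρ ρ' : ℝ} (hρ : 0 ≤ ρ) (hρ' : 0 ≤ ρ')
    (h : |z - z'| ≤ max ρ ρ') :
    min ρ ρ' ≤ volume.real (Metric.closedBall z ρ ∩ Metric.closedBall z' ρ') := by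
  rw [Real.closedBall_eq_Icc, Real.closedBall_eq_Icc, Set.Icc_inter_Icc, Real.volume_real_Icc]
  refine le_max_of_le_left ?_
  rw [abs_le] at h
  grind

/-- The number of `a` in `coprimeNumerators γ q` with `|x - (a + γ) / q| ≤ s / q`, real-valued
because its integrals are compared. -/
noncomputable def approxCount (γ : ℝ) (q : ℕ) (s x : ℝ) : ℝ :=
  ∑ a ∈ coprimeNumerators γ q, (Metric.closedBall (((a : ℝ) + γ) / q) (s / q)).indicator 1 x

theorem approxCount_nonneg (γ : ℝ) (q : ℕ) (s x : ℝ) : 0 ≤ approxCount γ q s x :=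
  sum_nonneg fun _ _ => Set.indicator_nonneg (fun _ _ => zero_le_one) _

theorem memLp_approxCount (γ : ℝ) (q : ℕ) (s : ℝ) (p : ENNReal) :
    MemLp (approxCount γ q s) p :=
  memLp_finsetSum _ fun _ _ =>
    memLp_indicator_const p measurableSet_closedBall 1 (.inr measure_closedBall_lt_top.ne)

theorem measurable_approxCount (γ : ℝ) (q : ℕ) (s : ℝ) : Measurable (approxCount γ q s) := by
  unfold approxCount
  exact Finset.measurable_sum _ fun _ _ => measurable_one.indicator measurableSet_closedBall

theorem setIntegral_approxCount (γ : ℝ) (q : ℕ) (s : ℝ) (A : Set ℝ) :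
    ∫ x in A, approxCount γ q s x = ∑ a ∈ coprimeNumerators γ q,
      volume.real (Metric.closedBall (((a : ℝ) + γ) / q) (s / q) ∩ A) := by
  simp only [approxCount]
  rw [integral_finsetSum _ fun a _ => Integrable.restrict ?_]
  · refine sum_congr rfl fun a _ => ?_
    rw [integral_indicator_one measurableSet_closedBall,
      measureReal_restrict_apply measurableSet_closedBall]
  · exact (integrableOn_const measure_closedBall_lt_top.ne).integrable_indicator
      measurableSet_closedBall

/-- The length of the overlap of the intervals of radii `s / q` and `t / r` around the shifted
fractions `(a + γ) / q` and `(b + γ) / r`, where `y = (a, b)`. -/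
noncomputable def approxOverlap (γ : ℝ) (q r : ℕ) (s t : ℝ) (y : ℤ × ℤ) : ℝ :=
  volume.real (Metric.closedBall (((y.1 : ℝ) + γ) / q) (s / q) ∩
    Metric.closedBall (((y.2 : ℝ) + γ) / r) (t / r))

theorem approxOverlap_le (γ : ℝ) (q r : ℕ) {s t : ℝ} (hs : 0 ≤ s) (ht : 0 ≤ t) (y : ℤ × ℤ) :
    approxOverlap γ q r s t y ≤ 2 * min (s / q) (t / r) :=
  volume_closedBall_inter_closedBall_le (by positivity) (by positivity)

theorem integral_approxCount_mul (γ : ℝ) (q r : ℕ) (s t : ℝ) :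
    ∫ x, approxCount γ q s x * approxCount γ r t x =
      ∑ y ∈ coprimeNumerators γ q ×ˢ coprimeNumerators γ r, approxOverlap γ q r s t y := by
  have mul_eq (x : ℝ) : approxCount γ q s x * approxCount γ r t x =
      ∑ y ∈ coprimeNumerators γ q ×ˢ coprimeNumerators γ r,
        (Metric.closedBall (((y.1 : ℝ) + γ) / q) (s / q) ∩
          Metric.closedBall (((y.2 : ℝ) + γ) / r) (t / r)).indicator 1 x := by
    rw [approxCount, approxCount, sum_mul_sum, ← sum_product']
    simp only [Set.inter_indicator_one, Pi.mul_apply]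
  have measurableSet_inter (z z' ρ ρ' : ℝ) :
      MeasurableSet (Metric.closedBall z ρ ∩ Metric.closedBall z' ρ') :=
    measurableSet_closedBall.inter measurableSet_closedBall
  simp only [mul_eq]
  rw [integral_finsetSum]
  · exact sum_congr rfl fun y _ => integral_indicator_one (measurableSet_inter ..)
  · exact fun y _ => (integrableOn_const (measure_ne_top_of_subset Set.inter_subset_left
      measure_closedBall_lt_top.ne)).integrable_indicator (measurableSet_inter ..)

theorem eq_and_eq_of_mul_eq_mul {a b : ℤ} {q r : ℕ} (hq : q ≠ 0) (ha : Int.gcd a q = 1)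
    (hb : Int.gcd b r = 1) (h : a * r = b * q) : q = r ∧ a = b := by
  have hqr : (q : ℤ) ∣ r :=
    (Int.isCoprime_iff_gcd_eq_one.2 ha).symm.dvd_of_dvd_mul_left ⟨b, by rw [h, mul_comm]⟩
  have hrq : (r : ℤ) ∣ q :=
    (Int.isCoprime_iff_gcd_eq_one.2 hb).symm.dvd_of_dvd_mul_left ⟨a, by rw [← h, mul_comm]⟩
  obtain rfl : q = r := Nat.dvd_antisymm (Int.natCast_dvd_natCast.1 hqr)
    (Int.natCast_dvd_natCast.1 hrq)
  exact ⟨rfl, mul_right_cancel₀ (by exact_mod_cast hq) h⟩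

theorem approxOverlap_eq_zero_of_lt {γ s t : ℝ} {q r : ℕ} (hq : q ≠ 0) (hr : r ≠ 0) {y : ℤ × ℤ}
    (h : s * r + t * q < |((y.1 : ℝ) + γ) * r - (y.2 + γ) * q|) :
    approxOverlap γ q r s t y = 0 := by
  have hq0 : (0 : ℝ) < q := by exact_mod_cast Nat.pos_of_ne_zero hq
  have hr0 : (0 : ℝ) < r := by exact_mod_cast Nat.pos_of_ne_zero hr
  have far : s / q + t / r < dist (((y.1 : ℝ) + γ) / q) ((y.2 + γ) / r) := by
    rw [Real.dist_eq, div_add_div _ _ hq0.ne' hr0.ne', div_sub_div _ _ hq0.ne' hr0.ne', abs_div,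
      abs_of_pos (mul_pos hq0 hr0)]
    gcongr
    simpa only [mul_comm] using h
  rw [approxOverlap, (Metric.closedBall_disjoint_closedBall far).inter_eq, measureReal_empty]

theorem min_div_mul_le {s t a b : ℝ} (hs : 0 ≤ s) (ht : 0 ≤ t) (ha : 0 < a) (hb : 0 < b) :
    min (s / a) (t / b) * (s * b + t * a) ≤ 2 * (s * t) :=
  calc min (s / a) (t / b) * (s * b + t * a)
      = min (s / a) (t / b) * (s * b) + min (s / a) (t / b) * (t * a) := mul_add _ _ _
    _ ≤ t / b * (s * b) + s / a * (t * a) := by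
        gcongr
        · exact min_le_right _ _
        · exact min_le_left _ _
    _ = 2 * (s * t) := by field_simp; ring

theorem sum_approxOverlap_distinct_le (γ : ℝ) {δ s t : ℝ} {q r : ℕ} (hδ : 0 < δ) (hq : q ≠ 0)
    (hr : r ≠ 0) (hs : δ ≤ s) (ht : δ ≤ t) :
    ∑ y ∈ coprimeNumerators γ q ×ˢ coprimeNumerators γ r with y.1 * (r : ℤ) ≠ y.2 * (q : ℤ),
      approxOverlap γ q r s t y ≤
      26880 * (1 + (|γ| + 1) / δ) * ((q.totient * s / q) * (r.totient * t / r)) := by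
  have hs0 : 0 ≤ s := hδ.le.trans hs
  have ht0 : 0 ≤ t := hδ.le.trans ht
  have hq0 : (0 : ℝ) < q := by exact_mod_cast Nat.pos_of_ne_zero hq
  have hr0 : (0 : ℝ) < r := by exact_mod_cast Nat.pos_of_ne_zero hr
  have card_le : (#(closePairs γ q r (s * r + t * q)) : ℝ) ≤ _ :=
    card_closePairs_le γ hδ hq hr (by nlinarith)
  have sum_close :
      ∑ y ∈ coprimeNumerators γ q ×ˢ coprimeNumerators γ r with y.1 * (r : ℤ) ≠ y.2 * (q : ℤ),
        approxOverlap γ q r s t y =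
          ∑ y ∈ closePairs γ q r (s * r + t * q), approxOverlap γ q r s t y := by
    rw [closePairs, ← filter_filter]
    refine (sum_filter_of_ne fun y _ hy => ?_).symm
    by_contra! far
    exact hy (approxOverlap_eq_zero_of_lt hq hr far)
  rw [sum_close]
  calc ∑ y ∈ closePairs γ q r (s * r + t * q), approxOverlap γ q r s t y
      ≤ #(closePairs γ q r (s * r + t * q)) * (2 * min (s / q) (t / r)) := by
        rw [← nsmul_eq_mul]
        exact sum_le_card_nsmul _ _ _ fun y _ => approxOverlap_le γ q r hs0 ht0 y
    _ ≤ 6720 * (1 + (|γ| + 1) / δ) * (s * r + t * q) *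
          (q.totient / q * (r.totient / r)) * (2 * min (s / q) (t / r)) := by gcongr
    _ = 13440 * (1 + (|γ| + 1) / δ) * (q.totient / q * (r.totient / r)) *
          (min (s / q) (t / r) * (s * r + t * q)) := by ring
    _ ≤ 13440 * (1 + (|γ| + 1) / δ) * (q.totient / q * (r.totient / r)) * (2 * (s * t)) := by
        refine mul_le_mul_of_nonneg_left (min_div_mul_le hs0 ht0 hq0 hr0) ?_
        positivity
    _ = _ := by ring

theorem sum_approxOverlap_coincident_le (γ : ℝ) {s t : ℝ} {q r : ℕ} (hq : q ≠ 0) (hs : 0 ≤ s)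
    (ht : 0 ≤ t) :
    ∑ y ∈ coprimeNumerators γ q ×ˢ coprimeNumerators γ r with ¬y.1 * (r : ℤ) ≠ y.2 * (q : ℤ),
      approxOverlap γ q r s t y ≤ if q = r then 8 * (q.totient * s / q) else 0 := by
  set T := {y ∈ coprimeNumerators γ q ×ˢ coprimeNumerators γ r |
    ¬y.1 * (r : ℤ) ≠ y.2 * (q : ℤ)} with hT
  have coincide : ∀ y ∈ T, q = r ∧ y.1 = y.2 := by
    intro y hy
    rw [hT, mem_filter, mem_product, not_not] at hy
    exact eq_and_eq_of_mul_eq_mul hq (mem_coprimeNumerators.1 hy.1.1).2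
      (mem_coprimeNumerators.1 hy.1.2).2 hy.2
  split_ifs with hqr
  · have card_le : #T ≤ 4 * q.totient := by
      refine (card_le_card_of_injOn Prod.fst (fun y hy => ?_) fun x hx y hy hxy => ?_).trans
        (card_coprimeNumerators_le γ hq)
      · have hy := (mem_filter.1 hy).1
        exact (mem_product.1 hy).1
      · exact Prod.ext hxy (by rw [← (coincide x hx).2, ← (coincide y hy).2, hxy])
    calc ∑ y ∈ T, approxOverlap γ q r s t y ≤ #T * (2 * (s / q)) := by
          rw [← nsmul_eq_mul]
          refine sum_le_card_nsmul _ _ _ fun y _ => (approxOverlap_le γ q r hs ht y).trans ?_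
          gcongr
          exact min_le_left _ _
      _ ≤ (4 * q.totient : ℕ) * (2 * (s / q)) := by gcongr
      _ = 8 * (q.totient * s / q) := by
          push_cast
          ring
  · exact (sum_eq_zero fun y hy => absurd (coincide y hy).1 hqr).le

theorem integral_approxCount_mul_le (γ : ℝ) {δ s t : ℝ} {q r : ℕ} (hδ : 0 < δ) (hs : 0 ≤ s)
    (ht : 0 ≤ t) (hsδ : q ≠ 0 → s ≠ 0 → δ ≤ s) (htδ : r ≠ 0 → t ≠ 0 → δ ≤ t) :
    ∫ x, approxCount γ q s x * approxCount γ r t x ≤ 26880 * (1 + (|γ| + 1) / δ) *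
      ((q.totient * s / q) * (r.totient * t / r) +
        if q = r then q.totient * s / q else 0) := by
  rw [integral_approxCount_mul]
  by_cases degenerate : (q = 0 ∨ s = 0) ∨ r = 0 ∨ t = 0
  · have min_eq : min (s / q) (t / r) ≤ 0 := by
      rw [min_le_iff]
      rcases degenerate with (rfl | rfl) | (rfl | rfl) <;> simp
    calc ∑ y ∈ coprimeNumerators γ q ×ˢ coprimeNumerators γ r, approxOverlap γ q r s t y ≤ 0 :=
          sum_nonpos fun y _ => (approxOverlap_le γ q r hs ht y).trans (by linarith)
      _ ≤ _ := by
          have : (0 : ℝ) ≤ if q = r then q.totient * s / q else 0 := by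
            split_ifs <;> positivity
          positivity
  push Not at degenerate
  obtain ⟨⟨hq, hs0⟩, hr, ht0⟩ := degenerate
  rw [← sum_filter_add_sum_filter_not _ fun y : ℤ × ℤ => y.1 * (r : ℤ) ≠ y.2 * (q : ℤ), mul_add]
  refine add_le_add (sum_approxOverlap_distinct_le γ hδ hq hr (hsδ hq hs0) (htδ hr ht0))
    ((sum_approxOverlap_coincident_le γ hq hs ht).trans ?_)
  have : 0 ≤ (|γ| + 1) / δ := by positivity
  split_ifs
  · gcongr
    linarith
  · simp

theorem card_mul_min_le_setIntegral_approxCount (γ : ℝ) {q : ℕ} (hq : q ≠ 0) {s c R m : ℝ}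
    (hs : 0 ≤ s) (hR : 0 ≤ R) (hcR : Metric.closedBall c R ⊆ Set.Icc 0 1) (hm : m = max (s / q) R)
    (hm1 : m ≤ 1) :
    #{a ∈ Icc ⌈q * (c - m) - γ⌉ ⌊q * (c + m) - γ⌋ | Int.gcd a q = 1} * min (s / q) R ≤
      ∫ x in Metric.closedBall c R, approxCount γ q s x := by
  rw [Real.closedBall_eq_Icc, Set.Icc_subset_Icc_iff (by linarith)] at hcR
  have hq0 : (0 : ℝ) < q := by exact_mod_cast Nat.pos_of_ne_zero hq
  set S := {a ∈ Icc ⌈q * (c - m) - γ⌉ ⌊q * (c + m) - γ⌋ | Int.gcd a q = 1} with hS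
  have mem_S {a : ℤ} (ha : a ∈ S) :
      (q * (c - m) - γ ≤ a ∧ (a : ℝ) ≤ q * (c + m) - γ) ∧ Int.gcd a q = 1 := by
    rwa [hS, mem_filter, mem_Icc, Int.ceil_le, Int.le_floor] at ha
  have subset : S ⊆ coprimeNumerators γ q := by
    intro a ha
    obtain ⟨⟨hlo, hhi⟩, hgcd⟩ := mem_S ha
    exact mem_coprimeNumerators.2 ⟨⟨by nlinarith, by nlinarith⟩, hgcd⟩
  have overlap_ge : ∀ a ∈ S, min (s / q) R ≤
      volume.real (Metric.closedBall (((a : ℝ) + γ) / q) (s / q) ∩ Metric.closedBall c R) := by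
    intro a ha
    obtain ⟨⟨hlo, hhi⟩, -⟩ := mem_S ha
    refine min_le_volume_closedBall_inter_closedBall (div_nonneg hs hq0.le) hR ?_
    rw [← hm, abs_le, le_sub_iff_add_le, sub_le_iff_le_add, le_div_iff₀ hq0, div_le_iff₀ hq0]
    constructor <;> linarith
  rw [setIntegral_approxCount, ← nsmul_eq_mul]
  exact (card_nsmul_le_sum _ _ _ overlap_ge).trans <|
    sum_le_sum_of_subset_of_nonneg subset fun _ _ _ => measureReal_nonneg

theorem eventually_le_setIntegral_approxCount (γ : ℝ) {ψ : ℕ → ℝ} (hψ : ∀ q, 0 ≤ ψ q)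
    (hψq : ∀ᶠ q : ℕ in atTop, ψ q < q) {c R : ℝ} (hR : 0 < R)
    (hcR : Metric.closedBall c R ⊆ Set.Icc 0 1) :
    ∀ᶠ q : ℕ in atTop, R * (q.totient * ψ q / q) ≤
      ∫ x in Metric.closedBall c R, approxCount γ q (ψ q) x := by
  have hR1 : R ≤ 1 := by
    rw [Real.closedBall_eq_Icc, Set.Icc_subset_Icc_iff (by linarith)] at hcR
    linarith
  filter_upwards [hψq, eventually_le_card_coprime_Icc hR, eventually_ne_atTop 0]
    with q hψq card_ge hq
  have hq0 : (0 : ℝ) < q := by exact_mod_cast Nat.pos_of_ne_zero hq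
  have hρ0 : 0 ≤ ψ q / q := div_nonneg (hψ q) hq0.le
  set m := max (ψ q / q) R with hm
  have hRm : R ≤ m := le_max_right _ _
  have card_ge : m * q.totient ≤
      #{a ∈ Icc ⌈q * (c - m) - γ⌉ ⌊q * (c + m) - γ⌋ | Int.gcd a q = 1} := by
    convert card_ge (q * (c - m) - γ) (q * (c + m) - γ) (by nlinarith) using 1
    field_simp
    ring
  calc R * (q.totient * ψ q / q) = m * q.totient * min (ψ q / q) R := by
        rw [mul_right_comm, hm, mul_comm (max _ R), min_mul_max]
        ring
    _ ≤ #{a ∈ Icc ⌈q * (c - m) - γ⌉ ⌊q * (c + m) - γ⌋ | Int.gcd a q = 1} *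
          min (ψ q / q) R := by gcongr
    _ ≤ _ := card_mul_min_le_setIntegral_approxCount γ hq (hψ q) hR.le hcR hm <|
        max_le ((div_lt_one hq0).2 hψq).le hR1

end ApproxCount

section BorelCantelli

variable {α : Type*} [MetricSpace α] [SecondCountableTopology α] [HasBesicovitchCovering α]
  [MeasurableSpace α] [BorelSpace α] {μ : Measure α}

theorem exists_finset_pairwiseDisjoint_closedBall_lt_measure [SFinite μ] {V : Set α}
    (hV : IsOpen V) {m : ENNReal} (hm : m < μ V) :
    ∃ (s : Finset α) (r : α → ℝ), (∀ x ∈ s, 0 < r x ∧ Metric.closedBall x (r x) ⊆ V) ∧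
      (s : Set α).PairwiseDisjoint (fun x => Metric.closedBall x (r x)) ∧
      m < μ (⋃ x ∈ s, Metric.closedBall x (r x)) := by
  classical
  have small_ball : ∀ x ∈ V, ∀ δ > 0,
      ({ρ : ℝ | Metric.closedBall x ρ ⊆ V} ∩ Set.Ioo 0 δ).Nonempty := by
    intro x hx δ hδ
    obtain ⟨ε, hε, hεV⟩ := Metric.nhds_basis_closedBall.mem_iff.1 (hV.mem_nhds hx)
    refine ⟨min ε (δ / 2), (Metric.closedBall_subset_closedBall (min_le_left _ _)).trans hεV,
      lt_min hε (half_pos hδ), (min_le_right _ _).trans_lt (half_lt_self hδ)⟩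
  obtain ⟨t, r, countable, -, hr, ae_cover, disjoint⟩ :=
    Besicovitch.exists_disjoint_closedBall_covering_ae μ _ V small_ball (fun _ => 1)
      fun _ _ => one_pos
  have measure_le : μ V ≤ μ (⋃ x ∈ t, Metric.closedBall x (r x)) :=
    measure_mono_ae (ae_le_set.2 ae_cover)
  rw [measure_biUnion countable disjoint fun _ _ => measurableSet_closedBall,
    ENNReal.tsum_eq_iSup_sum] at measure_le
  obtain ⟨s, hs⟩ := lt_iSup_iff.1 (hm.trans_le measure_le)
  have subset : ((s.map (Function.Embedding.subtype _) : Finset α) : Set α) ⊆ t := by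
    simp
  refine ⟨s.map (Function.Embedding.subtype _), r, fun x hx => ?_, disjoint.subset subset, ?_⟩
  · exact ⟨(hr x (subset hx)).2.1, (hr x (subset hx)).1⟩
  · rwa [measure_biUnion_finset (disjoint.subset subset) fun _ _ => measurableSet_closedBall,
      Finset.sum_map]

theorem setIntegral_le_mul_measureReal_add {α : Type*} [MeasurableSpace α] {μ : Measure α}
    [IsFiniteMeasure μ] {f : α → ℝ} (hf : MemLp f 2 μ) (s : Set α) {t : ℝ} (ht : 0 < t) :
    ∫ x in s, f x ∂μ ≤ t * μ.real s + (∫ x, f x ^ 2 ∂μ) / (4 * t) := by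
  have am_gm (x : α) : f x ≤ t + f x ^ 2 / (4 * t) := by
    rw [← sub_nonneg]
    have : t + f x ^ 2 / (4 * t) - f x = (f x - 2 * t) ^ 2 / (4 * t) := by
      field_simp
      ring
    rw [this]
    positivity
  have hsq : Integrable (fun x => f x ^ 2 / (4 * t)) μ := hf.integrable_sq.div_const _
  calc ∫ x in s, f x ∂μ ≤ ∫ x in s, (t + f x ^ 2 / (4 * t)) ∂μ :=
        integral_mono (hf.integrable one_le_two).restrict
          ((integrable_const t).add hsq.restrict) am_gm
    _ = t * μ.real s + ∫ x in s, f x ^ 2 / (4 * t) ∂μ := by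
        rw [integral_add (integrable_const t) hsq.restrict, setIntegral_const, smul_eq_mul,
          mul_comm]
    _ ≤ t * μ.real s + (∫ x, f x ^ 2 ∂μ) / (4 * t) := by
        rw [← integral_div]
        refine add_le_add le_rfl (setIntegral_le_integral hsq ?_)
        exact Eventually.of_forall fun x => by positivity

theorem exists_finset_pairwiseDisjoint_closedBall_measureReal_sdiff_lt [IsFiniteMeasure μ]
    {Ω B : Set α} (hΩ : IsOpen Ω) (hB : MeasurableSet B) (hBΩ : B ⊆ Ω) {m ε : ℝ} (hm : 0 ≤ m)
    (hmB : m < μ.real B) (hε : 0 < ε) :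
    ∃ (s : Finset α) (r : α → ℝ), (∀ x ∈ s, 0 < r x ∧ Metric.closedBall x (r x) ⊆ Ω) ∧
      (s : Set α).PairwiseDisjoint (fun x => Metric.closedBall x (r x)) ∧
      m < μ.real (⋃ x ∈ s, Metric.closedBall x (r x)) ∧
      μ.real ((⋃ x ∈ s, Metric.closedBall x (r x)) \ B) < ε := by
  obtain ⟨V, hBV, hV, -, hVB⟩ := hB.exists_isOpen_sdiff_lt (measure_ne_top μ B)
    (ε := ENNReal.ofReal ε) (by positivity)
  have lt_measure : ENNReal.ofReal m < μ (V ∩ Ω) :=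
    ((ENNReal.ofReal_lt_iff_lt_toReal hm (measure_ne_top _ _)).2 hmB).trans_le
      (measure_mono (Set.subset_inter hBV hBΩ))
  obtain ⟨s, r, hs, disjoint, hA⟩ :=
    exists_finset_pairwiseDisjoint_closedBall_lt_measure (hV.inter hΩ) lt_measure
  refine ⟨s, r, fun x hx => ⟨(hs x hx).1, (hs x hx).2.trans Set.inter_subset_right⟩, disjoint,
    (ENNReal.ofReal_lt_iff_lt_toReal hm (measure_ne_top _ _)).1 hA, ?_⟩
  refine (ENNReal.lt_ofReal_iff_toReal_lt (measure_ne_top _ _)).1 ((measure_mono ?_).trans_lt hVB)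
  exact Set.sdiff_subset_sdiff_left (Set.iUnion₂_subset fun x hx =>
    (hs x hx).2.trans Set.inter_subset_left)

theorem measure_eq_zero_of_le_setIntegral_closedBall [IsFiniteMeasure μ] {ι : Type*}
    {l : Filter ι} [l.NeBot] {G : ι → α → ℝ} {Ω B : Set α} {c C : ℝ} (hΩ : IsOpen Ω) (hc : 0 < c)
    (hG : ∀ i, MemLp (G i) 2 μ) (hsq : ∀ᶠ i in l, ∫ x, G i x ^ 2 ∂μ ≤ C)
    (hball : ∀ x r, 0 < r → Metric.closedBall x r ⊆ Ω →
      ∀ᶠ i in l, c * μ.real (Metric.closedBall x r) ≤ ∫ y in Metric.closedBall x r, G i y ∂μ)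
    (hB : MeasurableSet B) (hBΩ : B ⊆ Ω) (hGB : ∀ i, ∀ x ∈ B, G i x = 0) : μ B = 0 := by
  by_contra hne
  set β := μ.real B
  have hβ : 0 < β := ENNReal.toReal_pos hne (measure_ne_top _ _)
  set t : ℝ := (|C| + 1) / (c * β) with ht_def
  have ht : 0 < t := by positivity
  obtain ⟨s, r, hs, disjoint, hβA, hAB⟩ :=
    exists_finset_pairwiseDisjoint_closedBall_measureReal_sdiff_lt (μ := μ) hΩ hB hBΩ
      (half_pos hβ).le (half_lt_self hβ) (ε := c * β / (4 * t)) (by positivity)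
  set A := ⋃ x ∈ s, Metric.closedBall x (r x)
  have lower : ∀ᶠ i in l, ∀ x ∈ s, c * μ.real (Metric.closedBall x (r x)) ≤
      ∫ y in Metric.closedBall x (r x), G i y ∂μ :=
    (eventually_all_finset s).2 fun x hx => hball x (r x) (hs x hx).1 (hs x hx).2
  obtain ⟨i, lower, hsq⟩ := (lower.and hsq).exists
  have integrable : Integrable (G i) μ := (hG i).integrable one_le_two
  have key : c * (β / 2) < c * (β / 2) :=
    calc c * (β / 2) < c * μ.real A := by gcongr
      _ ≤ ∫ x in A, G i x ∂μ := by
          rw [measureReal_biUnion_finset disjoint fun _ _ => measurableSet_closedBall,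
            integral_biUnion_finset s (fun _ _ => measurableSet_closedBall) disjoint
              fun _ _ => integrable.integrableOn, Finset.mul_sum]
          exact Finset.sum_le_sum lower
      _ = ∫ x in A \ B, G i x ∂μ :=
          setIntegral_eq_of_subset_of_forall_sdiff_eq_zero
            (s.measurableSet_biUnion fun _ _ => measurableSet_closedBall) Set.sdiff_subset
            fun x hx => hGB i x (by_contra fun h => hx.2 ⟨hx.1, h⟩)
      _ ≤ t * μ.real (A \ B) + (∫ x, G i x ^ 2 ∂μ) / (4 * t) :=
          setIntegral_le_mul_measureReal_add (hG i) _ ht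
      _ ≤ t * (c * β / (4 * t)) + (|C| + 1) / (4 * t) := by
          gcongr
          linarith [le_abs_self C]
      _ = c * (β / 2) := by
          rw [ht_def]
          field_simp
          ring
  exact key.false

theorem eventually_mul_sum_range_le {κ : ℝ} {w a : ℕ → ℝ} (hκ : 0 ≤ κ)
    (hdiv : Tendsto (fun Q => ∑ q ∈ Finset.range Q, w q) atTop atTop) (ha : ∀ q, 0 ≤ a q)
    (h : ∀ᶠ q in atTop, κ * w q ≤ a q) :
    ∀ᶠ Q in atTop, κ / 2 * ∑ q ∈ Finset.range Q, w q ≤ ∑ q ∈ Finset.range Q, a q := by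
  obtain ⟨N, hN⟩ := eventually_atTop.1 h
  filter_upwards [hdiv.eventually_ge_atTop (2 * ∑ q ∈ Finset.range N, w q),
    eventually_ge_atTop N] with Q hQ hNQ
  rw [← Finset.sum_range_add_sum_Ico _ hNQ] at hQ
  calc κ / 2 * ∑ q ∈ Finset.range Q, w q
      = κ / 2 * (∑ q ∈ Finset.range N, w q + ∑ q ∈ Finset.Ico N Q, w q) := by
        rw [Finset.sum_range_add_sum_Ico _ hNQ]
    _ ≤ κ / 2 * (2 * ∑ q ∈ Finset.Ico N Q, w q) := by
        gcongr
        linarith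
    _ = ∑ q ∈ Finset.Ico N Q, κ * w q := by
        rw [← Finset.mul_sum]
        ring
    _ ≤ ∑ q ∈ Finset.Ico N Q, a q := Finset.sum_le_sum fun q hq => hN q (Finset.mem_Ico.1 hq).1
    _ ≤ ∑ q ∈ Finset.range Q, a q := by
        rw [← Finset.sum_range_add_sum_Ico _ hNQ]
        exact le_add_of_nonneg_left (Finset.sum_nonneg fun q _ => ha q)

theorem integral_sum_sq_le {α ι : Type*} [MeasurableSpace α] [DecidableEq ι] {μ : Measure α}
    {f : ι → α → ℝ} {w : ι → ℝ} {C : ℝ} (hf : ∀ i, MemLp (f i) 2 μ)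
    (hpair : ∀ i j, ∫ x, f i x * f j x ∂μ ≤ C * (w i * w j + if i = j then w i else 0))
    (s : Finset ι) :
    ∫ x, (∑ i ∈ s, f i x) ^ 2 ∂μ ≤ C * ((∑ i ∈ s, w i) ^ 2 + ∑ i ∈ s, w i) := by
  have integrable (i j : ι) : Integrable (fun x => f i x * f j x) μ := (hf i).integrable_mul (hf j)
  calc ∫ x, (∑ i ∈ s, f i x) ^ 2 ∂μ = ∑ i ∈ s, ∑ j ∈ s, ∫ x, f i x * f j x ∂μ := by
        simp only [sq, Finset.sum_mul_sum]
        rw [integral_finsetSum _ fun i _ => integrable_finsetSum _ fun j _ => integrable i j]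
        exact Finset.sum_congr rfl fun i _ => integral_finsetSum _ fun j _ => integrable i j
    _ ≤ ∑ i ∈ s, ∑ j ∈ s, C * (w i * w j + if i = j then w i else 0) :=
        Finset.sum_le_sum fun i _ => Finset.sum_le_sum fun j _ => hpair i j
    _ = C * ((∑ i ∈ s, w i) ^ 2 + ∑ i ∈ s, w i) := by
        simp only [← Finset.mul_sum, Finset.sum_add_distrib, sq, Finset.sum_mul_sum,
          Finset.sum_ite_eq, Finset.sum_ite_mem, Finset.inter_self]

theorem measure_eq_zero_of_forall_eq_zero [IsFiniteMeasure μ] {f : ℕ → α → ℝ} {w : ℕ → ℝ}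
    {Ω B : Set α} {c C : ℝ} (hΩ : IsOpen Ω) (hc : 0 < c) (hf : ∀ q, MemLp (f q) 2 μ)
    (hf0 : ∀ q x, 0 ≤ f q x) (hw : ∀ q, 0 ≤ w q) (hdiv : ¬Summable w)
    (hball : ∀ x r, 0 < r → Metric.closedBall x r ⊆ Ω → ∀ᶠ q in atTop,
      c * μ.real (Metric.closedBall x r) * w q ≤ ∫ y in Metric.closedBall x r, f q y ∂μ)
    (hpair : ∀ q r, ∫ x, f q x * f r x ∂μ ≤ C * (w q * w r + if q = r then w q else 0))
    (hB : MeasurableSet B) (hBΩ : B ⊆ Ω) (hfB : ∀ q, ∀ x ∈ B, f q x = 0) : μ B = 0 := by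
  set W : ℕ → ℝ := fun Q => ∑ q ∈ Finset.range Q, w q
  have tendsto_W : Tendsto W atTop atTop :=
    (not_summable_iff_tendsto_nat_atTop_of_nonneg hw).1 hdiv
  have integrable (q : ℕ) : Integrable (f q) μ := (hf q).integrable one_le_two
  refine measure_eq_zero_of_le_setIntegral_closedBall (l := atTop)
    (G := fun Q x => (W Q)⁻¹ * ∑ q ∈ Finset.range Q, f q x) (C := |C| * 2) hΩ (half_pos hc)
    (fun Q => (memLp_finsetSum _ fun q _ => hf q).const_mul _) ?_ (fun x r hr hxr => ?_) hB hBΩ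
    fun Q x hx => by rw [Finset.sum_eq_zero fun q _ => hfB q x hx, mul_zero]
  · filter_upwards [tendsto_W.eventually_ge_atTop 1] with Q hQ
    have : 0 < W Q := one_pos.trans_le hQ
    calc ∫ x, ((W Q)⁻¹ * ∑ q ∈ Finset.range Q, f q x) ^ 2 ∂μ
        = (W Q)⁻¹ ^ 2 * ∫ x, (∑ q ∈ Finset.range Q, f q x) ^ 2 ∂μ := by
          simp only [mul_pow, integral_const_mul]
      _ ≤ (W Q)⁻¹ ^ 2 * (C * (W Q ^ 2 + W Q)) := by
          gcongr
          exact integral_sum_sq_le hf hpair _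
      _ ≤ (W Q)⁻¹ ^ 2 * (|C| * (W Q ^ 2 + W Q ^ 2)) := by
          gcongr
          · exact le_abs_self C
          · nlinarith
      _ = |C| * 2 := by
          field_simp
          ring
  · filter_upwards [eventually_mul_sum_range_le (by positivity) tendsto_W
      (fun q => integral_nonneg (hf0 q)) (hball x r hr hxr),
      tendsto_W.eventually_gt_atTop 0] with Q hQ hWQ
    rw [integral_const_mul, integral_finsetSum _ fun q _ => (integrable q).restrict,
      le_inv_mul_iff₀ hWQ]
    linarith

theorem ae_frequently_ne_zero [IsFiniteMeasure μ] {f : ℕ → α → ℝ} {w : ℕ → ℝ}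
    {Ω : Set α} {c C : ℝ} (hΩ : IsOpen Ω) (hc : 0 < c) (hfm : ∀ q, Measurable (f q))
    (hf : ∀ q, MemLp (f q) 2 μ) (hf0 : ∀ q x, 0 ≤ f q x) (hw : ∀ q, 0 ≤ w q)
    (hdiv : ¬Summable w)
    (hball : ∀ x r, 0 < r → Metric.closedBall x r ⊆ Ω → ∀ᶠ q in atTop,
      c * μ.real (Metric.closedBall x r) * w q ≤ ∫ y in Metric.closedBall x r, f q y ∂μ)
    (hpair : ∀ q r, ∫ x, f q x * f r x ∂μ ≤ C * (w q * w r + if q = r then w q else 0)) :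
    ∀ᵐ x ∂μ, x ∈ Ω → ∃ᶠ q in atTop, f q x ≠ 0 := by
  have tail_null (N : ℕ) : μ (Ω ∩ ⋂ q, {x | f (q + N) x = 0}) = 0 :=
    measure_eq_zero_of_forall_eq_zero hΩ hc (fun q => hf (q + N)) (fun q => hf0 (q + N))
      (fun q => hw (q + N)) ((summable_nat_add_iff N).not.2 hdiv)
      (fun x r hr hxr => (tendsto_add_atTop_nat N).eventually (hball x r hr hxr))
      (fun q r => by simpa using hpair (q + N) (r + N))
      (hΩ.measurableSet.inter (MeasurableSet.iInter fun q =>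
        measurableSet_eq_fun (hfm (q + N)) measurable_const))
      Set.inter_subset_left fun q x hx => Set.mem_iInter.1 hx.2 q
  filter_upwards [ae_all_iff.2 fun N => measure_eq_zero_iff_ae_notMem.1 (tail_null N)] with x hx hxΩ
  rw [frequently_atTop]
  intro N
  by_contra! vanish
  exact hx N ⟨hxΩ, Set.mem_iInter.2 fun q => vanish (q + N) (Nat.le_add_left N q)⟩

end BorelCantelli

theorem coprimeApproxSet_eq_Icc (γ : ℝ) {ψ : ℕ → ℝ≥0} {q : ℕ} (hq : q ≠ 0)
    (hψ : (q : ℝ) ≤ ψ q) : coprimeApproxSet γ ψ q = Set.Icc 0 1 := by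
  refine Set.Subset.antisymm (fun x hx => hx.1) fun x hx => ⟨hx, ?_⟩
  have hq0 : (0 : ℝ) < q := by exact_mod_cast Nat.pos_of_ne_zero hq
  set j : ℤ := ⌊(q * x - γ - 1) / q⌋
  refine ⟨1 + j * q, Int.isCoprime_iff_gcd_eq_one.1 (isCoprime_one_left.add_mul_right_left j), ?_⟩
  have floor_le : (j : ℝ) * q ≤ q * x - γ - 1 := (le_div_iff₀ hq0).1 (Int.floor_le _)
  have lt_floor : q * x - γ - 1 < (j + 1) * q := (div_lt_iff₀ hq0).1 (Int.lt_floor_add_one _)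
  have error_eq : x - (((1 + j * q : ℤ) : ℝ) + γ) / q = (q * x - γ - 1 - j * q) / q := by
    push_cast
    field_simp
    ring
  rw [error_eq, abs_div, abs_of_pos hq0]
  gcongr
  rw [abs_le]
  constructor <;> linarith

theorem mem_coprimeApproxSet_of_approxCount_ne_zero {γ x : ℝ} {ψ : ℕ → ℝ≥0} {q : ℕ}
    (hx : x ∈ Set.Icc 0 1) (h : approxCount γ q (ψ q) x ≠ 0) : x ∈ coprimeApproxSet γ ψ q := by
  obtain ⟨a, ha, hxa⟩ := Finset.exists_ne_zero_of_sum_ne_zero h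
  have mem_ball := Set.mem_of_indicator_ne_zero hxa
  rw [Metric.mem_closedBall, Real.dist_eq] at mem_ball
  exact ⟨hx, a, (mem_coprimeNumerators.1 ha).2, mem_ball⟩

theorem ae_frequently_mem_coprimeApproxSet {γ δ : ℝ} (hδ : 0 < δ) {ψ : ℕ → ℝ≥0}
    (hψ : ∀ q, q ≠ 0 → ψ q ≠ 0 → δ ≤ ψ q)
    (hdiv : ¬Summable fun q : ℕ => (q.totient : ℝ) * ψ q / q) :
    ∀ᵐ x ∂volume.restrict (Set.Ioo 0 1), ∃ᶠ q in atTop, x ∈ coprimeApproxSet γ ψ q := by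
  have ae_mem := ae_restrict_mem (μ := volume) (measurableSet_Ioo (a := (0 : ℝ)) (b := 1))
  by_cases large : ∃ᶠ q : ℕ in atTop, (q : ℝ) ≤ ψ q
  · filter_upwards [ae_mem] with x hx
    refine (large.and_eventually (eventually_ne_atTop 0)).mono fun q hq => ?_
    rw [coprimeApproxSet_eq_Icc γ hq.2 hq.1]
    exact Set.Ioo_subset_Icc_self hx
  have small : ∀ᶠ q : ℕ in atTop, (ψ q : ℝ) < q := by
    simpa only [not_frequently, not_le] using large
  have lower (c R : ℝ) (hR : 0 < R) (hcR : Metric.closedBall c R ⊆ Set.Ioo 0 1) :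
      ∀ᶠ q : ℕ in atTop, 1 / 2 * (volume.restrict (Set.Ioo 0 1)).real (Metric.closedBall c R) *
        (q.totient * ψ q / q) ≤
          ∫ x in Metric.closedBall c R, approxCount γ q (ψ q) x ∂volume.restrict (Set.Ioo 0 1) := by
    rw [measureReal_restrict_apply measurableSet_closedBall,
      Measure.restrict_restrict measurableSet_closedBall, Set.inter_eq_left.2 hcR,
      Real.volume_real_closedBall hR.le]
    filter_upwards [eventually_le_setIntegral_approxCount γ (fun q => (ψ q).coe_nonneg) small hR
      (hcR.trans Set.Ioo_subset_Icc_self)] with q hq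
    linarith
  have pair (q r : ℕ) :=
    (setIntegral_le_integral (s := Set.Ioo 0 1)
      ((memLp_approxCount γ q (ψ q) 2).integrable_mul (memLp_approxCount γ r (ψ r) 2))
      (Eventually.of_forall fun x =>
        mul_nonneg (approxCount_nonneg γ q (ψ q) x) (approxCount_nonneg γ r (ψ r) x))).trans
      (integral_approxCount_mul_le γ hδ (ψ q).coe_nonneg (ψ r).coe_nonneg
        (fun hq hψq => hψ q hq (by exact_mod_cast hψq))
        fun hr hψr => hψ r hr (by exact_mod_cast hψr))
  filter_upwards [ae_mem, ae_frequently_ne_zero isOpen_Ioo one_half_pos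
    (fun q => measurable_approxCount γ q (ψ q))
    (fun q => (memLp_approxCount γ q (ψ q) 2).restrict _)
    (fun q => approxCount_nonneg γ q (ψ q)) (fun q => by positivity) hdiv lower pair]
    with x hx hfreq
  exact (hfreq hx).mono fun q => mem_coprimeApproxSet_of_approxCount_ne_zero
    (Set.Ioo_subset_Icc_self hx)

theorem theorem5p2 (γ δ : ℝ) (hδ : 0 < δ) (ψ : ℕ → ℝ≥0)
    (hψ : ∀ q : ℕ, 1 ≤ q → ψ q ≠ 0 → δ ≤ (ψ q : ℝ))
    (hdiv : Tendsto
      (fun Q : ℕ => ∑ q ∈ Finset.Icc 1 Q, (Nat.totient q : ℝ) * (ψ q : ℝ) / (q : ℝ))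
      atTop atTop) :
    volume (limsup (fun q : ℕ => coprimeApproxSet γ ψ q) atTop) = 1 := by
  have not_summable : ¬Summable fun q : ℕ => (q.totient : ℝ) * ψ q / q := by
    intro summable
    obtain ⟨Q, hQ⟩ := (hdiv.eventually_gt_atTop (∑' q : ℕ, (q.totient : ℝ) * ψ q / q)).exists
    exact hQ.not_ge (summable.sum_le_tsum _ fun q _ => by positivity)
  have ae_mem := ae_frequently_mem_coprimeApproxSet (γ := γ) hδ
    (fun q hq => hψ q (Nat.one_le_iff_ne_zero.2 hq)) not_summable
  simp only [← mem_limsup_iff_frequently_mem] at ae_mem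
  apply le_antisymm
  · calc volume (limsup (coprimeApproxSet γ ψ) atTop) ≤ volume (Set.Icc (0 : ℝ) 1) := by
          refine measure_mono fun x hx => ?_
          obtain ⟨q, hq⟩ := (mem_limsup_iff_frequently_mem.1 hx).exists
          exact hq.1
      _ = 1 := by rw [Real.volume_Icc, sub_zero, ENNReal.ofReal_one]
  · calc 1 = volume (Set.Ioo (0 : ℝ) 1) := by rw [Real.volume_Ioo, sub_zero, ENNReal.ofReal_one]
      _ ≤ volume (limsup (coprimeApproxSet γ ψ) atTop) :=
          measure_mono_ae ((ae_restrict_iff' measurableSet_Ioo).1 ae_mem)
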